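/- Let $\Gamma$ be a finite abelian group and let $(G,H,\Gamma_G)$ be a $\Gamma$-symmetric space: $G$ is a connected real Lie group, $\Gamma_G=\{\rho_\gamma:\gamma\in\Gamma\}$ is a group of smooth automorphisms of $G$ with $\gamma\mapsto\rho_\gamma$ an injective homomorphism, and $H$ is a closed subgroup of $G$, containing no proper nontrivial normal subgroup of $G$, that lies between the subgroup $G_\Gamma$ of common fixed points of the $\rho_\gamma$ and the identity component of $G_\Gamma$. Let $M=G/H$ carry the smooth structure for which $\pi:G\to G/H$ is a submersion, and let $g$ be a $G$-invariant Riemannian metric on $M$ for which all the symmetries $s_{(\gamma,aH)}(y)=a\,s_{(\gamma,\bar e)}(a^{-1}y)$, where $s_{(\gamma,\bar e)}(bH)=\rho_\gamma(b)H$, are isometries. Let $\mathfrak g$ be the Lie algebra of $G$ and $\tau_\gamma=(d\rho_\gamma)_e$. For a character $\chi:\Gamma\to\mathbb C^\times$ put $\mathfrak g_\chi=\{Z\in\mathfrak g\otimes\mathbb C:\tau_\gamma Z=\chi(\gamma)Z\ \ \forall\gamma\in\Gamma\}$ (the $\Gamma$-grading, indexed by the character group of $\Gamma$, which is isomorphic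 to $\Gamma$), let $\mathfrak g_e=\mathfrak g\cap\mathfrak g_{1}=\{X\in\mathfrak g:\tau_\gamma X=X\ \ \forall\gamma\}$ and $\mathfrak m=\mathfrak g\cap\bigoplus_{\chi\neq1}\mathfrak g_\chi$. Let $\nabla$ be the canonical connection of $G/H$, that is, the affine connection induced by the connection on the principal bundle $G\to G/H$ whose horizontal space at $a\in G$ is $(L_a)_*\mathfrak m$; let $T$ be its torsion, and let $\overline\nabla=\nabla-\tfrac12T$ be the canonical torsion-free connection. If the Levi-Civita connection of $g$ coincides with $\overline\nabla$, then $(G/H,g)$ is naturally reductive with respect to the decomposition $\mathfrak g=\mathfrak g_e\oplus\mathfrak m$. That is: $\mathfrak g_e=\ker (d\pi)_e$ is the Lie algebra of $H$, $\mathfrak g=\mathfrak g_e\oplus\mathfrak m$, $\mathrm{Ad}(H)\mathfrak m\subset\mathfrak m$, and the form $B(X,Y)=g_{\bar e}(d\pi_eX,d\pi_eY)$ satisfies $$B(X,[Z,Y]_{\mathfrak m})+B([Z,X]_{\mathfrak m},Y)=0\qquad\text{for all }X,Y,Z\in\mathfrak m,$$ where $[\cdot,\cdot]_{\mathfrak m}$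 is the component of the bracket in $\mathfrak m$ along $\mathfrak g_e$. -/

import Mathlib

open scoped Manifold ContDiff TensorProduct
open Bundle

noncomputable section

namespace GammaSymmetric

section GroupSide

variable {E : Type*} [NormedAddCommGroup E] [NormedSpace ℝ E]
  {G : Type*} [TopologicalSpace G] [Group G] [ChartedSpace E G]
  {Γ : Type*} [CommGroup Γ]

/-- The subgroup `G_Γ` of the elements of `G` fixed by all the automorphisms `ρ γ`. -/
def fixedSubgroup (ρ : Γ →* MulAut G) : Subgroup G where
  carrier := {a | ∀ γ, ρ γ a = a}
  mul_mem' := fun ha hb γ => by rw [map_mul, ha γ, hb γ]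
  one_mem' := fun γ => map_one (ρ γ)
  inv_mem' := fun ha γ => by rw [map_inv, ha γ]

variable (E) in
/-- `(G, H, Γ_G)` is a `Γ`-symmetric space, where `Γ_G = {ρ γ : γ ∈ Γ}` is a group of smooth
automorphisms of the Lie group `G` isomorphic to `Γ`: the closed subgroup `H` lies between `G_Γ`
and its identity component, and contains no proper nontrivial normal subgroup of `G`. -/
structure IsGammaSymmetric (ρ : Γ →* MulAut G) (H : Subgroup G) : Prop where
  injective : Function.Injective ρ
  contMDiff : ∀ γ, ContMDiff 𝓘(ℝ, E) 𝓘(ℝ, E) ∞ (ρ γ : G → G)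
  isClosed : IsClosed (H : Set G)
  le_fixed : H ≤ fixedSubgroup ρ
  identityComponent_subset : connectedComponentIn (fixedSubgroup ρ : Set G) 1 ⊆ (H : Set G)
  effective : ∀ N : Subgroup G, N.Normal → N ≤ H → N = ⊥ ∨ N = ⊤

variable (E) in
/-- The automorphism `τ γ` of the Lie algebra `𝔤` of `G` induced by `ρ γ`, i.e. the differential
of `ρ γ` at the identity (note that `ρ γ 1 = 1`). -/
def tau (ρ : Γ →* MulAut G) (γ : Γ) :
    GroupLieAlgebra 𝓘(ℝ, E) G →ₗ[ℝ] GroupLieAlgebra 𝓘(ℝ, E) G where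
  toFun X := (mfderiv 𝓘(ℝ, E) 𝓘(ℝ, E) (ρ γ : G → G) (1 : G)) X
  map_add' X Y := (mfderiv 𝓘(ℝ, E) 𝓘(ℝ, E) (ρ γ : G → G) (1 : G)).map_add X Y
  map_smul' c X := (mfderiv 𝓘(ℝ, E) 𝓘(ℝ, E) (ρ γ : G → G) (1 : G)).map_smul c X

variable (E) in
/-- The homogeneous component `𝔤_χ` of `𝔤 ⊗ ℂ`, for a character `χ` of `Γ`: the common eigenspace
on which every `τ γ` acts as `χ γ`. The grading group of the `Γ`-grading is the character group of
`Γ`, which is isomorphic to `Γ`; its identity `e` is the trivial character. -/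
def gradedComponent (ρ : Γ →* MulAut G) (χ : Γ →* ℂˣ) :
    Submodule ℂ (ℂ ⊗[ℝ] GroupLieAlgebra 𝓘(ℝ, E) G) where
  carrier := {Z | ∀ γ, (tau E ρ γ).baseChange ℂ Z = ((χ γ : ℂˣ) : ℂ) • Z}
  add_mem' := fun ha hb γ => by rw [map_add, ha γ, hb γ, smul_add]
  zero_mem' := fun γ => by rw [map_zero, smul_zero]
  smul_mem' := fun c Z hZ γ => by rw [map_smul, hZ γ, smul_comm]

variable (E G) in
/-- The real subspace of `𝔤` of the vectors lying in a given complex subspace of `𝔤 ⊗ ℂ`. -/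
def realPoints (W : Submodule ℂ (ℂ ⊗[ℝ] GroupLieAlgebra 𝓘(ℝ, E) G)) :
    Submodule ℝ (GroupLieAlgebra 𝓘(ℝ, E) G) :=
  (W.restrictScalars ℝ).comap (TensorProduct.mk ℝ ℂ (GroupLieAlgebra 𝓘(ℝ, E) G) 1)

variable (E) in
/-- `𝔤_e`, the component of `𝔤` of degree the identity. -/
def gE (ρ : Γ →* MulAut G) : Submodule ℝ (GroupLieAlgebra 𝓘(ℝ, E) G) :=
  realPoints E G (gradedComponent E ρ 1)

variable (E) in
/-- `𝔪 = ⨁_{γ ≠ e} 𝔤_γ`. -/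
def mPart (ρ : Γ →* MulAut G) : Submodule ℝ (GroupLieAlgebra 𝓘(ℝ, E) G) :=
  realPoints E G (⨆ χ : {χ : Γ →* ℂˣ // χ ≠ 1}, gradedComponent E ρ χ.1)

variable (E) in
/-- The adjoint representation of `G` on `𝔤`: the differential at `1` of the conjugation by `h`. -/
def Ad (h : G) : GroupLieAlgebra 𝓘(ℝ, E) G →ₗ[ℝ] GroupLieAlgebra 𝓘(ℝ, E) G where
  toFun X := (mfderiv 𝓘(ℝ, E) 𝓘(ℝ, E) (fun a : G => h * a * h⁻¹) (1 : G)) X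
  map_add' X Y := (mfderiv 𝓘(ℝ, E) 𝓘(ℝ, E) (fun a : G => h * a * h⁻¹) (1 : G)).map_add X Y
  map_smul' c X := (mfderiv 𝓘(ℝ, E) 𝓘(ℝ, E) (fun a : G => h * a * h⁻¹) (1 : G)).map_smul c X

end GroupSide

section Symmetries

variable {G : Type*} [Group G] {Γ : Type*} [CommGroup Γ]

/-- The symmetry `s_(γ, ē)` of `G ⧸ H` at the base point, `s (aH) = ρ γ a H`. -/
def baseSymmetry (ρ : Γ →* MulAut G) (H : Subgroup G) (hH : H ≤ fixedSubgroup ρ) (γ : Γ) :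
    G ⧸ H → G ⧸ H :=
  Quotient.map' (ρ γ) (fun a b hab => by
    rw [QuotientGroup.leftRel_apply] at hab ⊢
    rw [← map_inv, ← map_mul, hH hab γ]
    exact hab)

/-- The symmetry `s_(γ, x)` of `G ⧸ H` at the point `x = aH`, `s y = a s_(γ, ē) (a⁻¹ y)`. -/
def symmetryAt (ρ : Γ →* MulAut G) (H : Subgroup G) (hH : H ≤ fixedSubgroup ρ) (γ : Γ) (a : G) :
    G ⧸ H → G ⧸ H :=
  fun y => a • baseSymmetry ρ H hH γ (a⁻¹ • y)

end Symmetries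

section Connections

variable {F : Type*} [NormedAddCommGroup F] [NormedSpace ℝ F] [FiniteDimensional ℝ F]
  {M : Type*} [TopologicalSpace M] [ChartedSpace F M] [IsManifold 𝓘(ℝ, F) ∞ M]

/-- `cov - ½ T`, where `T` is the torsion of `cov`: the connection
`(X, Y) ↦ ∇_X Y - ½ T(X, Y) = ∇_X Y + ½ T(Y, X)`. -/
def torsionFreePart (cov : CovariantDerivative 𝓘(ℝ, F) F (fun x : M => TangentSpace 𝓘(ℝ, F) x)) :
    CovariantDerivative 𝓘(ℝ, F) F (fun x : M => TangentSpace 𝓘(ℝ, F) x) :=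
  cov.addOneForm (fun x => (1 / 2 : ℝ) • cov.torsion x)

/-- Two affine connections coincide: they agree on differentiable vector fields (the value of a
`CovariantDerivative` at other vector fields has no meaning). -/
def Coincide (cov cov' : CovariantDerivative 𝓘(ℝ, F) F (fun x : M => TangentSpace 𝓘(ℝ, F) x)) :
    Prop :=
  ∀ (Y : Π x : M, TangentSpace 𝓘(ℝ, F) x) (x : M), MDiffAt (T% Y) x → cov Y x = cov' Y x

variable [RiemannianBundle (fun x : M => TangentSpace 𝓘(ℝ, F) x)]
  [IsContMDiffRiemannianBundle 𝓘(ℝ, F) ∞ F (fun x : M => TangentSpace 𝓘(ℝ, F) x)]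

/-- `cov` is the Levi-Civita connection: it is torsion-free and metric. -/
def IsLeviCivita (cov : CovariantDerivative 𝓘(ℝ, F) F (fun x : M => TangentSpace 𝓘(ℝ, F) x)) :
    Prop :=
  cov.torsion = 0 ∧
    CovariantDerivative.IsMetricCompatible (E := F) (I := 𝓘(ℝ, F)) (M := M) (F := F)
      (V := fun x : M => TangentSpace 𝓘(ℝ, F) x) (by exact cov)

/-- The tangent maps of `f` preserve the Riemannian metric. -/
def PreservesMetric (f : M → M) : Prop :=
  ∀ (x : M) (v w : TangentSpace 𝓘(ℝ, F) x),
    inner ℝ (mfderiv 𝓘(ℝ, F) 𝓘(ℝ, F) f x v) (mfderiv 𝓘(ℝ, F) 𝓘(ℝ, F) f x w) = inner ℝ v w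

end Connections

section Homogeneous

variable {E : Type*} [NormedAddCommGroup E] [NormedSpace ℝ E]
  {F : Type*} [NormedAddCommGroup F] [NormedSpace ℝ F]
  {G : Type*} [TopologicalSpace G] [Group G] [ChartedSpace E G]
  {Γ : Type*} [CommGroup Γ]
  {H : Subgroup G} [ChartedSpace F (G ⧸ H)]

variable (E F H) in
/-- The differential at `1` of the projection `π : G → G ⧸ H`, from `𝔤` to the tangent space at the
base point. -/
def dpi : GroupLieAlgebra 𝓘(ℝ, E) G →L[ℝ] TangentSpace 𝓘(ℝ, F) (QuotientGroup.mk 1 : G ⧸ H) :=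
  mfderiv 𝓘(ℝ, E) 𝓘(ℝ, F) (QuotientGroup.mk : G → G ⧸ H) (1 : G)

/-- The function `f_Y : G → T_o (G ⧸ H)`, `f_Y b = (b⁻¹)_* (Y (bH))`, that represents a vector field
`Y` on `G ⧸ H` when the tangent bundle is seen as the bundle associated with the principal bundle
`G → G ⧸ H`. The tangent space at the base point `o = b⁻¹ • bH` is identified with the model `F`. -/
def frameRep (Y : Π x : G ⧸ H, TangentSpace 𝓘(ℝ, F) x) (b : G) : F :=
  mfderiv 𝓘(ℝ, F) 𝓘(ℝ, F) (fun y : G ⧸ H => b⁻¹ • y) (b : G ⧸ H) (Y b)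

/-- `cov` is the canonical connection of `G ⧸ H` for the complement `𝔪` of the Lie algebra of `H`:
the affine connection induced by the connection on the principal bundle `G → G ⧸ H` whose horizontal
space at `a` is `(L_a)_* 𝔪` (the kernel of the `Lie H`-component of the canonical `1`-form of `G`).
Thus `∇_v Y` at `aH`, for `v = π_* (L_a)_* X` with `X ∈ 𝔪`, is `a_*` of the derivative of `f_Y` at
`a` in the direction of the horizontal lift `(L_a)_* X` of `v`. -/
def IsCanonicalConnection (m : Submodule ℝ (GroupLieAlgebra 𝓘(ℝ, E) G))
    [IsManifold 𝓘(ℝ, F) ∞ (G ⧸ H)]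
    (cov : CovariantDerivative 𝓘(ℝ, F) F (fun x : G ⧸ H => TangentSpace 𝓘(ℝ, F) x)) : Prop :=
  ∀ (Y : Π x : G ⧸ H, TangentSpace 𝓘(ℝ, F) x) (a : G), MDiffAt (T% Y) (a : G ⧸ H) →
    ∀ X ∈ m,
      (cov Y (a : G ⧸ H) (mfderiv 𝓘(ℝ, E) 𝓘(ℝ, F) (QuotientGroup.mk : G → G ⧸ H) a
        (mulInvariantVectorField X a)) : F) =
      (mfderiv 𝓘(ℝ, F) 𝓘(ℝ, F) (fun y : G ⧸ H => a • y) (QuotientGroup.mk 1 : G ⧸ H)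
        (mfderiv 𝓘(ℝ, E) 𝓘(ℝ, F) (frameRep Y) a (mulInvariantVectorField X a) : F) : F)

section Metric

variable [FiniteDimensional ℝ F] [IsManifold 𝓘(ℝ, F) ∞ (G ⧸ H)]
  [RiemannianBundle (fun x : G ⧸ H => TangentSpace 𝓘(ℝ, F) x)]
  [IsContMDiffRiemannianBundle 𝓘(ℝ, F) ∞ F (fun x : G ⧸ H => TangentSpace 𝓘(ℝ, F) x)]

variable (F) in
/-- The Riemannian metric of `G ⧸ H` is `G`-invariant and the symmetries at all points are
isometries, i.e. `G ⧸ H` is a Riemannian `Γ`-symmetric space. -/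
structure IsRiemannianGammaSymmetric (ρ : Γ →* MulAut G) (hH : H ≤ fixedSubgroup ρ) : Prop where
  invariant : ∀ a : G, PreservesMetric (F := F) (fun y : G ⧸ H => a • y)
  isometry : ∀ (γ : Γ) (a : G), PreservesMetric (F := F) (symmetryAt ρ H hH γ a)

variable (F) in
/-- The metric is adapted to the `Γ`-structure: the Levi-Civita connection coincides with the
canonical torsion-free connection `∇ - ½ T`, where `∇` is the canonical connection and `T` its
torsion. -/
def IsAdapted (m : Submodule ℝ (GroupLieAlgebra 𝓘(ℝ, E) G)) : Prop :=
  ∃ covLC covCan : CovariantDerivative 𝓘(ℝ, F) F (fun x : G ⧸ H => TangentSpace 𝓘(ℝ, F) x),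
    IsLeviCivita covLC ∧ IsCanonicalConnection m covCan ∧ Coincide covLC (torsionFreePart covCan)

variable (F H) in
/-- The bilinear form `B` on `𝔤` given by the metric at the base point. On a complement of the Lie
algebra of `H` it is the inner product that corresponds to the metric. -/
def formB (X Y : GroupLieAlgebra 𝓘(ℝ, E) G) : ℝ :=
  inner ℝ (dpi E F H X) (dpi E F H Y)

variable (F H) in
/-- `G ⧸ H`, with its `G`-invariant Riemannian metric, is naturally reductive with respect to the
decomposition `𝔤 = 𝔥 ⊕ 𝔪`: `𝔥` is the Lie algebra of `H` (the kernel of `dπ`), `𝔪` is an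
`Ad H`-invariant complement of it, and `B(X, [Z, Y]_𝔪) + B([Z, X]_𝔪, Y) = 0` on `𝔪`. -/
structure IsNaturallyReductive (h m : Submodule ℝ (GroupLieAlgebra 𝓘(ℝ, E) G)) : Prop where
  ker_dpi : (dpi E F H).ker = h
  isCompl : IsCompl m h
  ad_mem : ∀ a ∈ H, ∀ X ∈ m, Ad E a X ∈ m
  skew : ∀ X ∈ m, ∀ Y ∈ m, ∀ Z ∈ m,
    formB F H X (m.projection h isCompl ⁅Z, Y⁆) + formB F H (m.projection h isCompl ⁅Z, X⁆) Y = 0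

end Metric

end Homogeneous

end GammaSymmetric

end

/-! The canonical connection `∇` of a reductive space preserves every invariant metric, and its
torsion at the base point is `T(X, Y) = -[X, Y]_𝔪`. If `∇ - ½T` is the Levi-Civita connection, it
preserves the metric too. Hence so does the difference: each endomorphism `T(·, Z)` with `Z ∈ 𝔪` is
skew for the metric (`metricForm_torsion_skew`). By the torsion formula (`torsion_canonical`) this
skewness is exactly natural reductivity.

Reductivity comes from averaging over `Γ`. The mean of the `τ γ` is a projection onto `𝔤_e`, and
character orthogonality in `𝔤 ⊗ ℂ` identifies its kernel with `𝔪`. It remains to see that `𝔤_e` is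
`ker dπ`. A vertical vector is fixed by each `τ γ`, because `ρ γ` fixes `H` pointwise and a local
section splits off the `H`-part of an element near `1`. Conversely, averaging a chart over `Γ`
linearizes the action near `1`; a fixed vector is then the velocity of a curve of fixed points,
which stays in the identity component of `G_Γ`, hence in `H`.

The torsion is computed with the fields that are constant in the chart at the base point `o`, whose
brackets vanish at `o`. If `A b = frameMap F H b` denotes translation by `b⁻¹` from `bH` to `o` in
that chart, then `∇` of the field `u` in the direction `dπ X` is `dA_1(X) u`. Since `A` carries the
projection of a left-invariant field to a constant, differentiating this constancy and
antisymmetrizing produces the Lie bracket. -/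

namespace GammaSymmetric

open Filter Set VectorField
open scoped Topology

/-! ### Local sections of submersions. -/

section Submersion

variable {E : Type*} [NormedAddCommGroup E] [NormedSpace ℝ E]
  {F : Type*} [NormedAddCommGroup F] [NormedSpace ℝ F]

/-- A submersion has smooth local sections through every point. -/
theorem exists_local_section {M N : Type*} [TopologicalSpace M] [ChartedSpace E M]
    [TopologicalSpace N] [ChartedSpace F N]
    [IsManifold 𝓘(ℝ, E) ∞ M] [IsManifold 𝓘(ℝ, F) ∞ N] {f : M → N} {x : M}
    (hf : Manifold.IsSubmersionAt 𝓘(ℝ, E) 𝓘(ℝ, F) ∞ f x) :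
    ∃ s : N → M, ContMDiffAt 𝓘(ℝ, F) 𝓘(ℝ, E) ∞ s (f x) ∧ s (f x) = x ∧
      ∀ᶠ y in 𝓝 (f x), f (s y) = y := by
  set d := hf.domChart
  set c := hf.codChart
  set e := hf.equiv
  have hxd : x ∈ d.source := hf.mem_domChart_source
  have hxc : f x ∈ c.source := hf.mem_codChart_source
  have hw : ∀ z ∈ d.target, c (f (d.symm z)) = (e z).1 := fun z hz => by
    have hz' : z ∈ (d.extend 𝓘(ℝ, E)).target := by simpa using hz
    simpa using hf.writtenInCharts hz'
  have hk : (e (d x)).1 = c (f x) := by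
    rw [← hw _ (d.map_source hxd), d.left_inv hxd]
  -- In adapted charts `f` is the first projection; the section keeps the complementary coordinate
  -- frozen at its value at `x`.
  let t : N → E := fun y => e.symm (c y, (e (d x)).2)
  have htx : t (f x) = d x := by
    simp only [t, ← hk, Prod.mk.eta, e.symm_apply_apply]
  have hc : ContMDiffAt 𝓘(ℝ, F) 𝓘(ℝ, F) ∞ c (f x) :=
    contMDiffAt_of_mem_maximalAtlas hf.codChart_mem_maximalAtlas hxc
  have ht : ContMDiffAt 𝓘(ℝ, F) 𝓘(ℝ, E) ∞ t (f x) := by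
    have : ContDiff ℝ ∞ (fun z : F => e.symm (z, (e (d x)).2)) := by fun_prop
    exact this.contMDiff.contMDiffAt.comp (f x) hc
  have hd : ContMDiffAt 𝓘(ℝ, E) 𝓘(ℝ, E) ∞ d.symm (t (f x)) := by
    rw [htx]
    exact contMDiffAt_symm_of_mem_maximalAtlas hf.domChart_mem_maximalAtlas (d.map_source hxd)
  refine ⟨d.symm ∘ t, hd.comp (f x) ht, ?_, ?_⟩
  · simp only [Function.comp_apply, htx, d.left_inv hxd]
  · have h1 : ∀ᶠ y in 𝓝 (f x), t y ∈ d.target :=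
      ht.continuousAt.eventually_mem
        (by rw [htx]; exact d.open_target.mem_nhds (d.map_source hxd))
    filter_upwards [h1, c.open_source.mem_nhds hxc] with y hy hyc
    have h2 : d.symm (t y) ∈ d.source := d.map_target hy
    have h3 : f (d.symm (t y)) ∈ c.source := hf.source_subset_preimage_source h2
    refine c.injOn h3 hyc ?_
    rw [hw _ hy]
    simp [t]

end Submersion

/-! ### Differentials read in the model spaces. -/

section Derivatives

variable {E E' E'' : Type*} [NormedAddCommGroup E] [NormedSpace ℝ E]
  [NormedAddCommGroup E'] [NormedSpace ℝ E'] [NormedAddCommGroup E''] [NormedSpace ℝ E'']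
  {M M' M'' : Type*} [TopologicalSpace M] [ChartedSpace E M]
  [TopologicalSpace M'] [ChartedSpace E' M'] [TopologicalSpace M''] [ChartedSpace E'' M'']

/-- The derivative of a map between manifolds without boundary, as a map between the model
spaces. -/
noncomputable def modelDeriv (f : M → M') (x : M) : E →L[ℝ] E' :=
  mfderiv 𝓘(ℝ, E) 𝓘(ℝ, E') f x

theorem modelDeriv_comp {g : M' → M''} {f : M → M'} {x : M} {y : M'}
    (hg : MDifferentiableAt 𝓘(ℝ, E') 𝓘(ℝ, E'') g y) (hf : MDifferentiableAt 𝓘(ℝ, E) 𝓘(ℝ, E') f x)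
    (hy : f x = y) : (modelDeriv (g ∘ f) x : E →L[ℝ] E'') =
      (modelDeriv g y : E' →L[ℝ] E'').comp (modelDeriv f x : E →L[ℝ] E') := by
  subst hy
  exact mfderiv_comp x hg hf

theorem modelDeriv_congr {f g : M → M'} {x : M} (h : f =ᶠ[𝓝 x] g) :
    (modelDeriv f x : E →L[ℝ] E') = modelDeriv g x :=
  h.mfderiv_eq

theorem modelDeriv_id {x : M} : (modelDeriv (id : M → M) x : E →L[ℝ] E) = .id ℝ E :=
  mfderiv_id

theorem modelDeriv_eq_fderiv {f : E → E'} {x : E} : modelDeriv f x = fderiv ℝ f x :=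
  mfderiv_eq_fderiv

/-- The differential at the identity of a product of maps into a Lie group. -/
theorem modelDeriv_mul_of_eq_one {G : Type*} [TopologicalSpace G] [Group G] [ChartedSpace E' G]
    [LieGroup 𝓘(ℝ, E') ∞ G] {f g : M → G} {x : M}
    (hf : MDifferentiableAt 𝓘(ℝ, E) 𝓘(ℝ, E') f x) (hg : MDifferentiableAt 𝓘(ℝ, E) 𝓘(ℝ, E') g x)
    (hfx : f x = 1) (hgx : g x = 1) :
    (modelDeriv (fun y => f y * g y) x : E →L[ℝ] E') = modelDeriv f x + modelDeriv g x := by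
  have hm : MDifferentiableAt (𝓘(ℝ, E').prod 𝓘(ℝ, E')) 𝓘(ℝ, E') (fun q : G × G => q.1 * q.2)
      (f x, g x) := (contMDiff_mul 𝓘(ℝ, E') ∞).contMDiffAt.mdifferentiableAt (by simp)
  have hp := hf.hasMFDerivAt.prodMk hg.hasMFDerivAt
  have hc := (hm.hasMFDerivAt.comp x hp).mfderiv
  ext v
  have h1 : (modelDeriv (fun y => f y * g y) x : E →L[ℝ] E') v =
      modelDeriv (fun a => a * g x) (f x) ((modelDeriv f x : E →L[ℝ] E') v) +
        modelDeriv (fun a => f x * a) (g x) ((modelDeriv g x : E →L[ℝ] E') v) :=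
    (congrArg (fun L : E →L[ℝ] E' => L v) hc).trans (mfderiv_prod_eq_add_apply hm)
  have h2 : (fun a : G => a * 1) = id := by ext; simp
  have h3 : (fun a : G => 1 * a) = id := by ext; simp
  rw [h1, hfx, hgx, h2, h3, modelDeriv_id]
  rfl

end Derivatives

/-! ### Smoothness of the action on `G ⧸ H`, and vertical vectors. -/

section Action

variable {E : Type*} [NormedAddCommGroup E] [NormedSpace ℝ E]
  {F : Type*} [NormedAddCommGroup F] [NormedSpace ℝ F]
  {G : Type*} [TopologicalSpace G] [Group G] [ChartedSpace E G] [LieGroup 𝓘(ℝ, E) ∞ G]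
  {H : Subgroup G} [ChartedSpace F (G ⧸ H)] [IsManifold 𝓘(ℝ, F) ∞ (G ⧸ H)]

/-- The action of `G` on `G ⧸ H` is smooth when the projection is a submersion. -/
theorem contMDiff_quotient_smul
    (hπ : Manifold.IsSubmersion 𝓘(ℝ, E) 𝓘(ℝ, F) ∞ (QuotientGroup.mk : G → G ⧸ H)) :
    ContMDiff (𝓘(ℝ, E).prod 𝓘(ℝ, F)) 𝓘(ℝ, F) ∞ (fun q : G × (G ⧸ H) => q.1 • q.2) := by
  rintro ⟨a, y⟩
  obtain ⟨g, rfl⟩ := QuotientGroup.mk_surjective y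
  obtain ⟨s, hs, hsg, hπs⟩ := exists_local_section (hπ.isSubmersionAt g)
  have hs' : ContMDiffAt (𝓘(ℝ, E).prod 𝓘(ℝ, F)) 𝓘(ℝ, E) ∞
      (fun q : G × (G ⧸ H) => q.1 * s q.2) (a, (g : G ⧸ H)) :=
    contMDiffAt_fst.mul (hs.comp (a, (g : G ⧸ H)) contMDiffAt_snd)
  have h := (hπ.contMDiff.contMDiffAt).comp (a, (g : G ⧸ H)) hs'
  refine h.congr_of_eventuallyEq ?_
  have h2 : ∀ᶠ q : G × (G ⧸ H) in 𝓝 (a, (g : G ⧸ H)), (s q.2 : G ⧸ H) = q.2 :=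
    (continuousAt_snd (p := (a, (g : G ⧸ H)))).eventually hπs
  filter_upwards [h2] with q hq
  change q.1 • q.2 = ((q.1 * s q.2 : G) : G ⧸ H)
  conv_lhs => rw [← hq]
  rfl

/-- A vector tangent to the fibre of `G → G ⧸ H` at `1` is fixed by every differentiable map that
fixes `H` pointwise. -/
theorem modelDeriv_eq_self_of_mk_eq_zero
    (hπ : Manifold.IsSubmersion 𝓘(ℝ, E) 𝓘(ℝ, F) ∞ (QuotientGroup.mk : G → G ⧸ H))
    {f : G → G} (hf : ContMDiff 𝓘(ℝ, E) 𝓘(ℝ, E) ∞ f) (hfix : ∀ a ∈ H, f a = a)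
    {X : E} (hX : modelDeriv (QuotientGroup.mk : G → G ⧸ H) (1 : G) X = (0 : F)) :
    modelDeriv f (1 : G) X = X := by
  obtain ⟨s, hs, hs1, hπs⟩ := exists_local_section (hπ.isSubmersionAt (1 : G))
  have hπ1 : ContMDiffAt 𝓘(ℝ, E) 𝓘(ℝ, F) ∞ (QuotientGroup.mk : G → G ⧸ H) 1 :=
    hπ.contMDiff.contMDiffAt
  have hsπ : ContMDiffAt 𝓘(ℝ, E) 𝓘(ℝ, E) ∞ (s ∘ (QuotientGroup.mk : G → G ⧸ H)) 1 :=
    hs.comp 1 hπ1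
  -- The component of `g` along the fibre: `s (gH)` and `g` lie in the same coset, so this lies in
  -- `H` for `g` near `1`.
  let h : G → G := fun g => (s (g : G ⧸ H))⁻¹ * g
  have hh : ContMDiffAt 𝓘(ℝ, E) 𝓘(ℝ, E) ∞ h 1 := hsπ.inv.mul contMDiffAt_id
  have hh1 : h 1 = 1 := by simp only [h, hs1]; simp
  have hmem : ∀ᶠ g in 𝓝 (1 : G), h g ∈ H := by
    filter_upwards [hπ1.continuousAt.eventually hπs] with g hg
    exact QuotientGroup.eq.1 hg
  have hne : (∞ : WithTop ℕ∞) ≠ 0 := by simp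
  have hsπd := hsπ.mdifferentiableAt hne
  have hhd := hh.mdifferentiableAt hne
  have hh_id : (fun g => (s ∘ (QuotientGroup.mk : G → G ⧸ H)) g * h g) = id := by
    ext g; simp [h]
  -- Differentiate `(s ∘ π) * h = id` at `1`: the first factor contributes `ds (dπ X) = 0`.
  have hdh : modelDeriv h (1 : G) X = X := by
    have h1 := congrArg (fun L : E →L[ℝ] E => L X) (modelDeriv_mul_of_eq_one hsπd hhd hs1 hh1)
    simp only [hh_id, modelDeriv_id] at h1
    rw [modelDeriv_comp (hs.mdifferentiableAt hne) (hπ1.mdifferentiableAt hne) rfl] at h1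
    simpa [hX] using h1.symm
  have hfh : f ∘ h =ᶠ[𝓝 1] h := by
    filter_upwards [hmem] with g hg using hfix _ hg
  have hc := modelDeriv_comp (hf.contMDiffAt.mdifferentiableAt hne) hhd hh1
  rw [modelDeriv_congr hfh] at hc
  calc modelDeriv f (1 : G) X = modelDeriv f (1 : G) (modelDeriv h (1 : G) X) := by rw [hdh]
    _ = modelDeriv h (1 : G) X := (congrArg (fun L : E →L[ℝ] E => L X) hc).symm
    _ = X := hdh

end Action

/-! ### The preferred chart at its own base point. -/

section Charts

variable {E : Type*} [NormedAddCommGroup E] [NormedSpace ℝ E]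
  {M : Type*} [TopologicalSpace M] [ChartedSpace E M] [IsManifold 𝓘(ℝ, E) ∞ M]

/-- The tangent space at `x` is identified with the model through this very chart, so its
differential at `x` is a trivial coordinate change. This holds only at the centre of the chart. -/
theorem modelDeriv_chartAt_self (x : M) :
    (modelDeriv (chartAt E x) x : E →L[ℝ] E) = .id ℝ E := by
  have : (modelDeriv (chartAt E x) x : E →L[ℝ] E) = tangentCoordChange 𝓘(ℝ, E) x x x :=
    mfderiv_chartAt_eq_tangentCoordChange (mem_chart_source E x)
  ext v
  rw [this]
  exact tangentCoordChange_self (by simp)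

theorem contMDiffAt_chartAt_self (x : M) : ContMDiffAt 𝓘(ℝ, E) 𝓘(ℝ, E) ∞ (chartAt E x) x :=
  contMDiffAt_of_mem_maximalAtlas (IsManifold.chart_mem_maximalAtlas x) (mem_chart_source E x)

theorem contMDiffAt_chartAt_symm_self (x : M) :
    ContMDiffAt 𝓘(ℝ, E) 𝓘(ℝ, E) ∞ (chartAt E x).symm (chartAt E x x) :=
  contMDiffAt_symm_of_mem_maximalAtlas (IsManifold.chart_mem_maximalAtlas x)
    ((chartAt E x).map_source (mem_chart_source E x))

theorem modelDeriv_chartAt_symm_self (x : M) :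
    (modelDeriv (chartAt E x).symm (chartAt E x x) : E →L[ℝ] E) = .id ℝ E := by
  have h := modelDeriv_comp (E := E) (E' := E) (E'' := E) (x := x)
    ((contMDiffAt_chartAt_symm_self x).mdifferentiableAt (by simp))
    ((contMDiffAt_chartAt_self x).mdifferentiableAt (by simp)) rfl
  rw [modelDeriv_congr (f := (chartAt E x).symm ∘ chartAt E x) (g := id)
    ((chartAt E x).eventually_left_inverse (mem_chart_source E x)), modelDeriv_id,
    modelDeriv_chartAt_self] at h
  simpa using h.symm

end Charts

/-! ### Linearizing the finite group action near the identity. -/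

section Linearization

variable {E : Type*} [NormedAddCommGroup E] [NormedSpace ℝ E]
  {G : Type*} [TopologicalSpace G] [Group G] [ChartedSpace E G]
  {Γ : Type*} [CommGroup Γ]

theorem modelDeriv_mulAut_mul {ρ : Γ →* MulAut G}
    (hρ : ∀ γ, ContMDiff 𝓘(ℝ, E) 𝓘(ℝ, E) ∞ (ρ γ : G → G)) (γ δ : Γ) :
    (modelDeriv (ρ (γ * δ) : G → G) 1 : E →L[ℝ] E) =
      (modelDeriv (ρ γ : G → G) 1 : E →L[ℝ] E).comp (modelDeriv (ρ δ : G → G) 1) := by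
  rw [← modelDeriv_comp ((hρ γ).contMDiffAt.mdifferentiableAt (by simp))
    ((hρ δ).contMDiffAt.mdifferentiableAt (by simp)) (map_one (ρ δ))]
  congr 1
  ext a
  simp

theorem modelDeriv_mulAut_one {ρ : Γ →* MulAut G} :
    (modelDeriv (ρ 1 : G → G) 1 : E →L[ℝ] E) = .id ℝ E := by
  rw [← modelDeriv_id (M := G) (x := 1)]
  congr 1
  ext a
  simp

theorem contMDiffAt_chart_mulAut [LieGroup 𝓘(ℝ, E) ∞ G] {ρ : Γ →* MulAut G}
    (hρ : ∀ γ, ContMDiff 𝓘(ℝ, E) 𝓘(ℝ, E) ∞ (ρ γ : G → G)) (γ : Γ) :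
    ContMDiffAt 𝓘(ℝ, E) 𝓘(ℝ, E) ∞ (chartAt E (1 : G) ∘ ρ γ) 1 :=
  ContMDiffAt.comp_of_eq (contMDiffAt_chartAt_self (1 : G)) (hρ γ).contMDiffAt (map_one (ρ γ))

variable [Fintype Γ]

variable (E) in
/-- The average over `Γ` of a chart at the identity, which intertwines the action of `Γ` with its
linearization. -/
noncomputable def averagedChart (ρ : Γ →* MulAut G) (g : G) : E :=
  (Fintype.card Γ : ℝ)⁻¹ • ∑ γ, (modelDeriv (ρ γ⁻¹ : G → G) 1 : E →L[ℝ] E)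
    (chartAt E (1 : G) (ρ γ g) - chartAt E (1 : G) 1)

/-- Reindexing the average by `γ ↦ γ * δ` pulls the differential of `ρ δ` out of the sum. -/
theorem averagedChart_apply_mulAut {ρ : Γ →* MulAut G}
    (hρ : ∀ γ, ContMDiff 𝓘(ℝ, E) 𝓘(ℝ, E) ∞ (ρ γ : G → G)) (δ : Γ) (g : G) :
    averagedChart E ρ (ρ δ g) =
      (modelDeriv (ρ δ : G → G) 1 : E →L[ℝ] E) (averagedChart E ρ g) := by
  simp only [averagedChart, map_smul, map_sum]
  congr 1
  refine Fintype.sum_equiv (Equiv.mulRight δ) _ _ fun γ => ?_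
  have h : γ⁻¹ = δ * (γ * δ)⁻¹ := by simp
  rw [Equiv.coe_mulRight, ← ContinuousLinearMap.comp_apply, ← modelDeriv_mulAut_mul hρ, ← h,
    map_mul]
  rfl

theorem averagedChart_one (ρ : Γ →* MulAut G) : averagedChart E ρ 1 = 0 := by
  simp [averagedChart]

variable [LieGroup 𝓘(ℝ, E) ∞ G]

/-- Each summand has derivative `τ γ⁻¹ ∘ τ γ = id`, so the mean has derivative `id`. This makes the
inverse function theorem applicable: the averaged chart is a local chart at `1`. -/
theorem contDiffAt_averagedChart_symm {ρ : Γ →* MulAut G}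
    (hρ : ∀ γ, ContMDiff 𝓘(ℝ, E) 𝓘(ℝ, E) ∞ (ρ γ : G → G)) :
    ContDiffAt ℝ ∞ (averagedChart E ρ ∘ (chartAt E (1 : G)).symm) (chartAt E (1 : G) 1) ∧
    HasFDerivAt (averagedChart E ρ ∘ (chartAt E (1 : G)).symm) (.id ℝ E : E →L[ℝ] E)
      (chartAt E (1 : G) 1) := by
  set ψ := chartAt E (1 : G)
  have hs : ∀ γ, ContMDiffAt 𝓘(ℝ, E) 𝓘(ℝ, E) ∞ ((ψ ∘ ρ γ) ∘ ψ.symm) (ψ 1) := fun γ =>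
    ContMDiffAt.comp_of_eq (contMDiffAt_chart_mulAut hρ γ) (contMDiffAt_chartAt_symm_self (1 : G))
      (ψ.left_inv (mem_chart_source E 1))
  have hf : ∀ γ, HasFDerivAt ((ψ ∘ ρ γ) ∘ ψ.symm) (modelDeriv (ρ γ : G → G) 1 : E →L[ℝ] E) (ψ 1) := by
    intro γ
    have h := ((hs γ).contDiffAt.differentiableAt (by simp)).hasFDerivAt
    rw [← modelDeriv_eq_fderiv, modelDeriv_comp
      ((contMDiffAt_chart_mulAut hρ γ).mdifferentiableAt (by simp))
      ((contMDiffAt_chartAt_symm_self (1 : G)).mdifferentiableAt (by simp))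
      (ψ.left_inv (mem_chart_source E 1)), modelDeriv_chartAt_symm_self, modelDeriv_comp
      ((contMDiffAt_chartAt_self (1 : G)).mdifferentiableAt (by simp))
      ((hρ γ).contMDiffAt.mdifferentiableAt (by simp)) (map_one (ρ γ)),
      modelDeriv_chartAt_self] at h
    simpa using h
  have he : averagedChart E ρ ∘ ψ.symm = fun z => (Fintype.card Γ : ℝ)⁻¹ •
      ∑ γ, (modelDeriv (ρ γ⁻¹ : G → G) 1 : E →L[ℝ] E) (((ψ ∘ ρ γ) ∘ ψ.symm) z - ψ 1) := rfl
  rw [he]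
  constructor
  · refine contDiffAt_const.smul (ContDiffAt.sum fun γ _ => ?_)
    exact (ContinuousLinearMap.contDiff _).contDiffAt.comp _
      ((hs γ).contDiffAt.sub contDiffAt_const)
  · have h := (HasFDerivAt.fun_sum (u := Finset.univ) fun γ _ =>
      ((modelDeriv (ρ γ⁻¹ : G → G) 1 : E →L[ℝ] E).hasFDerivAt.comp (ψ 1)
        ((hf γ).sub_const (ψ 1)))).const_smul (Fintype.card Γ : ℝ)⁻¹
    refine h.congr_fderiv ?_
    have h1 : ∀ γ : Γ, (modelDeriv (ρ γ⁻¹ : G → G) 1 : E →L[ℝ] E).comp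
        (modelDeriv (ρ γ : G → G) 1) = .id ℝ E := fun γ => by
      rw [← modelDeriv_mulAut_mul hρ, inv_mul_cancel, modelDeriv_mulAut_one]
    simp only [h1, Finset.sum_const, Finset.card_univ]
    rw [← Nat.cast_smul_eq_nsmul ℝ, smul_smul, inv_mul_cancel₀ (by simp), one_smul]

/-- A smooth curve of fixed points of `Γ` with a given initial velocity fixed by `Γ`. -/
theorem exists_fixed_curve [CompleteSpace E] {ρ : Γ →* MulAut G}
    (hρ : ∀ γ, ContMDiff 𝓘(ℝ, E) 𝓘(ℝ, E) ∞ (ρ γ : G → G)) {X : E}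
    (hX : ∀ γ, (modelDeriv (ρ γ : G → G) 1 : E →L[ℝ] E) X = X) :
    ∃ c : ℝ → G, c 0 = 1 ∧ ContMDiffAt 𝓘(ℝ, ℝ) 𝓘(ℝ, E) ∞ c 0 ∧
      (modelDeriv c 0 : ℝ →L[ℝ] E) 1 = X ∧
      ∃ ε > 0, ContinuousOn c (Metric.ball 0 ε) ∧
        ∀ t ∈ Metric.ball (0 : ℝ) ε, c t ∈ fixedSubgroup ρ := by
  classical
  obtain ⟨hsm, hder⟩ := contDiffAt_averagedChart_symm hρ
  set ψ := chartAt E (1 : G)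
  have h1ψ : (1 : G) ∈ ψ.source := mem_chart_source E 1
  have hne : (∞ : WithTop ℕ∞) ≠ 0 := by simp
  let e := hsm.toOpenPartialHomeomorph (f' := ContinuousLinearEquiv.refl ℝ E) _ hder hne
  have hecoe : (e : E → E) = averagedChart E ρ ∘ ψ.symm :=
    hsm.toOpenPartialHomeomorph_coe (f' := ContinuousLinearEquiv.refl ℝ E) hder hne
  have hesrc : ψ 1 ∈ e.source :=
    hsm.mem_toOpenPartialHomeomorph_source (f' := ContinuousLinearEquiv.refl ℝ E) hder hne
  have he0 : e (ψ 1) = 0 := by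
    rw [hecoe, Function.comp_apply, ψ.left_inv h1ψ, averagedChart_one]
  -- The averaged chart as a local homeomorphism; the required curve is the preimage of the line `t
  -- • X`.
  let T := ψ.trans e
  have hT : ∀ g ∈ T.source, T g = averagedChart E ρ g := by
    intro g hg
    rw [OpenPartialHomeomorph.trans_source] at hg
    change e (ψ g) = _
    rw [hecoe, Function.comp_apply, ψ.left_inv hg.1]
  have h1T : (1 : G) ∈ T.source := by
    rw [OpenPartialHomeomorph.trans_source]; exact ⟨h1ψ, hesrc⟩
  have hT1 : T 1 = 0 := he0
  have h0T : (0 : E) ∈ T.target := hT1 ▸ T.map_source h1T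
  have hTs0 : T.symm 0 = 1 := by rw [← hT1, T.left_inv h1T]
  have hlin : Continuous (fun t : ℝ => t • X) := by fun_prop
  have hes0 : e.symm 0 = ψ 1 := by rw [← he0, e.left_inv hesrc]
  have h0e : (0 : E) ∈ e.target := he0 ▸ e.map_source hesrc
  have hesm : ContDiffAt ℝ ∞ e.symm 0 :=
    e.contDiffAt_symm (f₀' := ContinuousLinearEquiv.refl ℝ E) h0e
      (by rw [hes0, hecoe]; exact hder) (by rw [hes0, hecoe]; exact hsm)
  have hTsm : ContMDiffAt 𝓘(ℝ, E) 𝓘(ℝ, E) ∞ T.symm 0 := by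
    refine ContMDiffAt.comp_of_eq (f := e.symm) (g := ψ.symm)
      (contMDiffAt_chartAt_symm_self (1 : G)) hesm.contMDiffAt hes0
  have hTd : (modelDeriv T.symm (0 : E) : E →L[ℝ] E) = .id ℝ E := by
    have h1 : (modelDeriv e.symm (0 : E) : E →L[ℝ] E) = .id ℝ E := by
      rw [modelDeriv_eq_fderiv]
      exact (e.hasFDerivAt_symm (f' := ContinuousLinearEquiv.refl ℝ E) h0e
        (by rw [hes0, hecoe]; exact hder)).fderiv
    have h2 := modelDeriv_comp (g := ψ.symm) (f := e.symm) (x := (0 : E))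
      ((contMDiffAt_chartAt_symm_self (1 : G)).mdifferentiableAt hne)
      (hesm.contMDiffAt.mdifferentiableAt hne) hes0
    rw [modelDeriv_chartAt_symm_self, h1] at h2
    exact h2
  have hcsm : ContMDiffAt 𝓘(ℝ, ℝ) 𝓘(ℝ, E) ∞ (fun t : ℝ => T.symm (t • X)) 0 := by
    have h : ContDiff ℝ ∞ (fun t : ℝ => t • X) := by fun_prop
    exact ContMDiffAt.comp_of_eq hTsm h.contMDiff.contMDiffAt (zero_smul ℝ X)
  have hmem : ∀ᶠ t : ℝ in 𝓝 0, t • X ∈ T.target :=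
    hlin.continuousAt.eventually_mem (by rw [zero_smul]; exact T.open_target.mem_nhds h0T)
  have hρmem : ∀ γ, ∀ᶠ t : ℝ in 𝓝 0, ρ γ (T.symm (t • X)) ∈ T.source := by
    intro γ
    have hcont : ContinuousAt (fun t : ℝ => ρ γ (T.symm (t • X))) 0 :=
      (hρ γ).continuous.continuousAt.comp hcsm.continuousAt
    exact hcont.eventually_mem
      (by rw [zero_smul, hTs0, map_one]; exact T.open_source.mem_nhds h1T)
  -- For such small `t` all the translates of the curve point by `ρ γ` stay in the domain where `T`
  -- is injective.
  obtain ⟨ε, hε, hball⟩ := Metric.eventually_nhds_iff_ball.1 (hmem.and (eventually_all.2 hρmem))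
  refine ⟨fun t => T.symm (t • X), by simp only [zero_smul, hTs0], hcsm, ?_, ε, hε, ?_, ?_⟩
  · have h := modelDeriv_comp (g := T.symm) (f := fun t : ℝ => t • X) (x := (0 : ℝ)) (y := 0)
      (hTsm.mdifferentiableAt hne)
      (by
        have h : DifferentiableAt ℝ (fun t : ℝ => t • X) 0 := by fun_prop
        exact h.mdifferentiableAt) (zero_smul ℝ X)
    rw [hTd, modelDeriv_eq_fderiv] at h
    have h3 : HasFDerivAt (fun t : ℝ => t • X) ((ContinuousLinearMap.id ℝ ℝ).smulRight X) 0 :=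
      (hasFDerivAt_id (𝕜 := ℝ) (0 : ℝ)).smul_const X
    rw [h3.fderiv] at h
    exact (congrArg (fun L : ℝ →L[ℝ] E => L 1) h).trans (by simp)
  · exact T.continuousOn_symm.comp hlin.continuousOn fun t ht => (hball t ht).1
  · intro t ht γ
    obtain ⟨h1, h2⟩ := hball t ht
    have h3 := T.map_target h1
    -- By equivariance `T` maps both points to `t • X`, since `τ γ (t • X) = t • X`.
    refine T.injOn (h2 γ) h3 ?_
    rw [hT _ (h2 γ), averagedChart_apply_mulAut hρ, ← hT _ h3, T.right_inv h1, map_smul, hX]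

/-- The vectors fixed by the linearized action of `Γ` are tangent to `H`. -/
theorem modelDeriv_mk_eq_zero_of_fixed [CompleteSpace E]
    {F : Type*} [NormedAddCommGroup F] [NormedSpace ℝ F]
    {ρ : Γ →* MulAut G} {H : Subgroup G} [ChartedSpace F (G ⧸ H)]
    (hρ : ∀ γ, ContMDiff 𝓘(ℝ, E) 𝓘(ℝ, E) ∞ (ρ γ : G → G))
    (hH : connectedComponentIn (fixedSubgroup ρ : Set G) 1 ⊆ (H : Set G))
    (hπ : MDifferentiableAt 𝓘(ℝ, E) 𝓘(ℝ, F) (QuotientGroup.mk : G → G ⧸ H) 1)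
    {X : E} (hX : ∀ γ, (modelDeriv (ρ γ : G → G) 1 : E →L[ℝ] E) X = X) :
    modelDeriv (QuotientGroup.mk : G → G ⧸ H) (1 : G) X = (0 : F) := by
  obtain ⟨c, hc0, hc, hcX, ε, hε, hcont, hfix⟩ := exists_fixed_curve hρ hX
  have hmem : ∀ t ∈ Metric.ball (0 : ℝ) ε, c t ∈ H := by
    intro t ht
    refine hH ?_
    have hpre : IsPreconnected (c '' Metric.ball 0 ε) :=
      (convex_ball (0 : ℝ) ε).isPreconnected.image _ hcont
    exact hpre.subset_connectedComponentIn ⟨0, Metric.mem_ball_self hε, hc0⟩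
      (by rintro _ ⟨s, hs, rfl⟩; exact hfix s hs) ⟨t, ht, rfl⟩
  -- The curve stays in `H`, so its projection is constant and `dπ` kills its velocity.
  have hconst : (QuotientGroup.mk : G → G ⧸ H) ∘ c =ᶠ[𝓝 0] fun _ => ((1 : G) : G ⧸ H) := by
    filter_upwards [Metric.ball_mem_nhds (0 : ℝ) hε] with t ht
    exact (QuotientGroup.eq.2 (by simpa using hmem t ht)).symm
  have h := modelDeriv_comp (x := (0 : ℝ)) hπ (hc.mdifferentiableAt (by simp)) hc0
  rw [modelDeriv_congr hconst] at h
  have h0 : (modelDeriv (fun _ : ℝ => ((1 : G) : G ⧸ H)) (0 : ℝ) : ℝ →L[ℝ] F) = 0 :=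
    mfderiv_const
  rw [h0] at h
  have := congrArg (fun L : ℝ →L[ℝ] F => L 1) h
  simpa [hcX] using this.symm

end Linearization

/-! ### Orthogonality of characters. -/

section Characters

variable {Γ : Type*} [CommGroup Γ]

/-- For `γ ≠ 1` some character `φ` has `φ γ ≠ 1`; multiplication by `φ` permutes the characters, so
the sum equals `φ γ` times itself. -/
theorem sum_character_apply [Fintype Γ] [Fintype (Γ →* ℂˣ)] [DecidableEq Γ] (γ : Γ) :
    ∑ χ : Γ →* ℂˣ, ((χ γ : ℂˣ) : ℂ) = if γ = 1 then (Fintype.card Γ : ℂ) else 0 := by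
  split_ifs with h
  · subst h
    have hc := CommGroup.card_monoidHom_of_hasEnoughRootsOfUnity Γ ℂ
    rw [Nat.card_eq_fintype_card, Nat.card_eq_fintype_card] at hc
    simp [hc]
  · obtain ⟨φ, hφ⟩ := CommGroup.exists_apply_ne_one_of_hasEnoughRootsOfUnity Γ ℂ h
    have h1 : ((φ γ : ℂˣ) : ℂ) * ∑ χ : Γ →* ℂˣ, ((χ γ : ℂˣ) : ℂ) =
        ∑ χ : Γ →* ℂˣ, ((χ γ : ℂˣ) : ℂ) := by
      rw [Finset.mul_sum]
      exact Fintype.sum_equiv (Equiv.mulLeft φ) _ _ fun χ => by simp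
    have h2 : (((φ γ : ℂˣ) : ℂ) - 1) * ∑ χ : Γ →* ℂˣ, ((χ γ : ℂˣ) : ℂ) = 0 := by
      rw [sub_mul, h1, one_mul, sub_self]
    refine (mul_eq_zero.1 h2).resolve_left fun h3 => hφ ?_
    exact Units.ext (sub_eq_zero.1 h3)

theorem sum_apply_of_ne_one [Fintype Γ] {χ : Γ →* ℂˣ} (hχ : χ ≠ 1) :
    ∑ γ, ((χ γ : ℂˣ) : ℂ) = 0 := by
  classical
  have h := sum_hom_units ((Units.coeHom ℂ).comp χ)
  rw [if_neg] at h
  · simpa using h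
  · intro h1
    refine hχ (MonoidHom.ext fun γ => Units.ext ?_)
    exact congrArg (fun f : Γ →* ℂ => f γ) h1

end Characters

/-! ### The reductive decomposition by averaging over `Γ`. -/

section Grading

variable {E : Type*} [NormedAddCommGroup E] [NormedSpace ℝ E]
  {G : Type*} [TopologicalSpace G] [Group G] [ChartedSpace E G]
  {Γ : Type*} [CommGroup Γ] {ρ : Γ →* MulAut G}

theorem tau_mul (hρ : ∀ γ, ContMDiff 𝓘(ℝ, E) 𝓘(ℝ, E) ∞ (ρ γ : G → G)) (γ δ : Γ)
    (X : GroupLieAlgebra 𝓘(ℝ, E) G) : tau E ρ (γ * δ) X = tau E ρ γ (tau E ρ δ X) :=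
  congrArg (fun L : E →L[ℝ] E => L X) (modelDeriv_mulAut_mul hρ γ δ)

theorem tau_one (X : GroupLieAlgebra 𝓘(ℝ, E) G) : tau E ρ 1 X = X :=
  congrArg (fun L : E →L[ℝ] E => L X) modelDeriv_mulAut_one

/-- Lets identities in `𝔤` be checked after complexification, where the grading lives. -/
theorem one_tmul_injective : Function.Injective
    (TensorProduct.mk ℝ ℂ (GroupLieAlgebra 𝓘(ℝ, E) G) 1) :=
  Module.FaithfullyFlat.tensorProduct_mk_injective (A := ℝ) (B := ℂ) (GroupLieAlgebra 𝓘(ℝ, E) G)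

theorem mem_gE {X : GroupLieAlgebra 𝓘(ℝ, E) G} : X ∈ gE E ρ ↔ ∀ γ, tau E ρ γ X = X := by
  have h : X ∈ gE E ρ ↔ ∀ γ, (tau E ρ γ).baseChange ℂ ((1 : ℂ) ⊗ₜ[ℝ] X) =
    (((1 : Γ →* ℂˣ) γ : ℂˣ) : ℂ) • ((1 : ℂ) ⊗ₜ[ℝ] X) := Iff.rfl
  rw [h]
  refine forall_congr' fun γ => ?_
  rw [MonoidHom.one_apply, Units.val_one, one_smul, LinearMap.baseChange_tmul]
  exact one_tmul_injective.eq_iff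

section Finite

variable [Fintype Γ]

variable (E) in
/-- The projection of `𝔤` onto the vectors fixed by `Γ`. -/
noncomputable def averageTau (ρ : Γ →* MulAut G) :
    GroupLieAlgebra 𝓘(ℝ, E) G →ₗ[ℝ] GroupLieAlgebra 𝓘(ℝ, E) G :=
  (Fintype.card Γ : ℝ)⁻¹ • ∑ γ, tau E ρ γ

theorem averageTau_apply (X : GroupLieAlgebra 𝓘(ℝ, E) G) :
    averageTau E ρ X = (Fintype.card Γ : ℝ)⁻¹ • ∑ γ, tau E ρ γ X := by
  simp [averageTau]

theorem averageTau_eq_zero_iff {X : GroupLieAlgebra 𝓘(ℝ, E) G} :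
    averageTau E ρ X = 0 ↔ ∑ γ, tau E ρ γ X = 0 := by
  rw [averageTau_apply, smul_eq_zero_iff_right (by simp)]

theorem isProj_averageTau (hρ : ∀ γ, ContMDiff 𝓘(ℝ, E) 𝓘(ℝ, E) ∞ (ρ γ : G → G)) :
    LinearMap.IsProj (gE E ρ) (averageTau E ρ) where
  map_mem X := by
    rw [mem_gE]
    intro δ
    rw [averageTau_apply, map_smul, map_sum]
    congr 1
    exact Fintype.sum_equiv (Equiv.mulLeft δ) _ _ fun γ => (tau_mul hρ δ γ X).symm
  map_id X hX := by
    rw [averageTau_apply, Finset.sum_congr rfl fun γ _ => mem_gE.1 hX γ, Finset.sum_const,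
      Finset.card_univ, ← Nat.cast_smul_eq_nsmul ℝ, smul_smul, inv_mul_cancel₀ (by simp), one_smul]

theorem sum_tau_eq_zero_of_mem_mPart {X : GroupLieAlgebra 𝓘(ℝ, E) G} (hX : X ∈ mPart E ρ) :
    ∑ γ, tau E ρ γ X = 0 := by
  let S : (ℂ ⊗[ℝ] GroupLieAlgebra 𝓘(ℝ, E) G) →ₗ[ℂ] (ℂ ⊗[ℝ] GroupLieAlgebra 𝓘(ℝ, E) G) :=
    ∑ γ, (tau E ρ γ).baseChange ℂ
  -- On `𝔤_χ` the operator `S` is multiplication by the sum of the values of `χ`, which vanishes for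
  -- `χ ≠ 1`.
  have hle : (⨆ χ : {χ : Γ →* ℂˣ // χ ≠ 1}, gradedComponent E ρ χ.1) ≤ LinearMap.ker S := by
    refine iSup_le fun χ Z hZ => ?_
    have hZ' : ∀ γ, (tau E ρ γ).baseChange ℂ Z = ((χ.1 γ : ℂˣ) : ℂ) • Z := hZ
    rw [LinearMap.mem_ker, LinearMap.sum_apply, Finset.sum_congr rfl fun γ _ => hZ' γ,
      ← Finset.sum_smul, sum_apply_of_ne_one χ.2, zero_smul]
  have h1 : S ((1 : ℂ) ⊗ₜ[ℝ] X) = 0 := hle hX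
  refine one_tmul_injective ?_
  rw [map_sum, map_zero, ← h1, LinearMap.sum_apply]
  rfl

/-- Fourier inversion on `Γ`: the vector is the sum of its isotypic components, and the hypothesis
says that the trivial one vanishes. -/
theorem mem_mPart_of_sum_tau_eq_zero
    (hρ : ∀ γ, ContMDiff 𝓘(ℝ, E) 𝓘(ℝ, E) ∞ (ρ γ : G → G)) {X : GroupLieAlgebra 𝓘(ℝ, E) G}
    (hX : ∑ γ, tau E ρ γ X = 0) : X ∈ mPart E ρ := by
  classical
  have : Fintype (Γ →* ℂˣ) := Fintype.ofFinite _
  -- The `χ`-isotypic component of `1 ⊗ X`, multiplied by the order of `Γ`.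
  let Z : (Γ →* ℂˣ) → (ℂ ⊗[ℝ] GroupLieAlgebra 𝓘(ℝ, E) G) := fun χ =>
    ∑ γ, ((χ γ⁻¹ : ℂˣ) : ℂ) • ((1 : ℂ) ⊗ₜ[ℝ] tau E ρ γ X)
  have hZ : ∀ χ, Z χ ∈ gradedComponent E ρ χ := by
    intro χ δ
    simp only [Z, map_sum, Finset.smul_sum, map_smul, LinearMap.baseChange_tmul]
    refine Fintype.sum_equiv (Equiv.mulLeft δ) _ _ fun γ => ?_
    rw [Equiv.coe_mulLeft, tau_mul hρ, smul_smul]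
    congr 1
    rw [← Units.val_mul, ← map_mul]
    simp
  have hZ1 : Z 1 = 0 := by
    simp only [Z, MonoidHom.one_apply, Units.val_one, one_smul]
    rw [← TensorProduct.tmul_sum, hX, TensorProduct.tmul_zero]
  -- Summing over `χ` first leaves only the term `γ = 1`.
  have hsum : ∑ χ, Z χ = (Fintype.card Γ : ℂ) • ((1 : ℂ) ⊗ₜ[ℝ] X) := by
    simp only [Z]
    rw [Finset.sum_comm]
    simp only [← Finset.sum_smul, sum_character_apply, inv_eq_one]
    rw [Finset.sum_eq_single 1 (fun γ _ hγ => by rw [if_neg hγ, zero_smul]) (by simp), if_pos rfl,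
      tau_one]
  have hmem : ∑ χ, Z χ ∈ ⨆ χ : {χ : Γ →* ℂˣ // χ ≠ 1}, gradedComponent E ρ χ.1 := by
    refine Submodule.sum_mem _ fun χ _ => ?_
    by_cases h : χ = 1
    · rw [h, hZ1]; exact Submodule.zero_mem _
    · exact Submodule.mem_iSup_of_mem (⟨χ, h⟩ : {χ : Γ →* ℂˣ // χ ≠ 1}) (hZ χ)
  rw [hsum] at hmem
  have h2 := Submodule.smul_mem _ ((Fintype.card Γ : ℂ)⁻¹) hmem
  rw [smul_smul, inv_mul_cancel₀ (by simp), one_smul] at h2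
  exact h2

theorem mPart_eq_ker (hρ : ∀ γ, ContMDiff 𝓘(ℝ, E) 𝓘(ℝ, E) ∞ (ρ γ : G → G)) :
    mPart E ρ = (averageTau E ρ).ker := by
  ext X
  rw [LinearMap.mem_ker, averageTau_eq_zero_iff]
  exact ⟨sum_tau_eq_zero_of_mem_mPart, mem_mPart_of_sum_tau_eq_zero hρ⟩

end Finite

theorem isCompl_mPart_gE [Finite Γ] (hρ : ∀ γ, ContMDiff 𝓘(ℝ, E) 𝓘(ℝ, E) ∞ (ρ γ : G → G)) :
    IsCompl (mPart E ρ) (gE E ρ) := by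
  have : Fintype Γ := Fintype.ofFinite Γ
  rw [mPart_eq_ker hρ]
  exact (isProj_averageTau hρ).isCompl.symm

/-- Conjugation by an element fixed by `Γ` commutes with every `ρ γ`, so `Ad a` commutes with the
averaging whose kernel is `𝔪`. -/
theorem Ad_mem_mPart [Finite Γ] [LieGroup 𝓘(ℝ, E) ∞ G]
    (hρ : ∀ γ, ContMDiff 𝓘(ℝ, E) 𝓘(ℝ, E) ∞ (ρ γ : G → G)) {a : G} (ha : a ∈ fixedSubgroup ρ)
    {X : GroupLieAlgebra 𝓘(ℝ, E) G} (hX : X ∈ mPart E ρ) : Ad E a X ∈ mPart E ρ := by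
  have : Fintype Γ := Fintype.ofFinite Γ
  refine mem_mPart_of_sum_tau_eq_zero hρ ?_
  let c : G → G := fun b => a * b * a⁻¹
  have hc : ContMDiff 𝓘(ℝ, E) 𝓘(ℝ, E) ∞ c :=
    (contMDiff_const.mul contMDiff_id).mul contMDiff_const
  have hc1 : c 1 = 1 := by simp [c]
  have hcomm : ∀ γ, tau E ρ γ (Ad E a X) = Ad E a (tau E ρ γ X) := by
    intro γ
    have h1 := modelDeriv_comp ((hρ γ).contMDiffAt.mdifferentiableAt (by simp))
      (hc.contMDiffAt.mdifferentiableAt (by simp)) hc1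
    have h2 := modelDeriv_comp (hc.contMDiffAt.mdifferentiableAt (by simp))
      ((hρ γ).contMDiffAt.mdifferentiableAt (by simp)) (map_one (ρ γ))
    have h3 : (ρ γ : G → G) ∘ c = c ∘ ρ γ := by
      ext b
      simp only [Function.comp_apply, c, map_mul, map_inv, ha γ]
    rw [h3, h2] at h1
    exact (congrArg (fun L : E →L[ℝ] E => L X) h1).symm
  simp only [hcomm, ← map_sum, sum_tau_eq_zero_of_mem_mPart hX, map_zero]

end Grading

/-! ### Lie brackets as commutators of derivations. -/

section LieBracket

variable {E F F' : Type*} [NormedAddCommGroup E] [NormedSpace ℝ E]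
  [NormedAddCommGroup F] [NormedSpace ℝ F] [NormedAddCommGroup F'] [NormedSpace ℝ F']
  {M : Type*} [TopologicalSpace M] [ChartedSpace E M]

theorem hasFDerivAt_comp_chartAt_symm {f : M → F} {x : M}
    (hf : MDifferentiableAt 𝓘(ℝ, E) 𝓘(ℝ, F) f x) :
    HasFDerivAt (f ∘ (chartAt E x).symm) (modelDeriv f x : E →L[ℝ] F) (chartAt E x x) := by
  have h := hf.hasMFDerivAt.2
  simp only [writtenInExtChartAt, mfld_simps] at h
  exact h.hasFDerivAt univ_mem

theorem modelDeriv_clm_apply {L : M → F →L[ℝ] F'} {w : M → F} {x : M}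
    (hL : MDifferentiableAt 𝓘(ℝ, E) 𝓘(ℝ, F →L[ℝ] F') L x)
    (hw : MDifferentiableAt 𝓘(ℝ, E) 𝓘(ℝ, F) w x) (v : E) :
    modelDeriv (fun y => L y (w y)) x v =
      (modelDeriv L x v : F →L[ℝ] F') (w x) + L x (modelDeriv w x v) := by
  have h1 := (hasFDerivAt_comp_chartAt_symm hL).clm_apply (hasFDerivAt_comp_chartAt_symm hw)
  have h2 := hasFDerivAt_comp_chartAt_symm (hL.clm_apply hw)
  have h3 := congrArg (fun A : E →L[ℝ] F' => A v) (h2.unique h1)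
  simp only [Function.comp_apply, (chartAt E x).left_inv (mem_chart_source E x)] at h3
  rw [h3]
  exact add_comm _ _

variable (E) in
/-- A vector field read in the chart at `x`. -/
noncomputable def chartField (x : M) (V : M → E) (z : E) : E :=
  (modelDeriv (chartAt E x).symm z : E →L[ℝ] E).inverse (V ((chartAt E x).symm z))

theorem mpullbackWithin_extChartAt_symm_eq (x : M) (V : Π y : M, TangentSpace 𝓘(ℝ, E) y) (z : E) :
    mpullbackWithin 𝓘(ℝ, E) 𝓘(ℝ, E) (extChartAt 𝓘(ℝ, E) x).symm V (range 𝓘(ℝ, E)) z =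
      chartField E x V z := by
  simp only [mpullbackWithin_apply, modelWithCornersSelf_coe, range_id, mfderivWithin_univ]
  simp only [mfld_simps]
  rfl

variable [IsManifold 𝓘(ℝ, E) ∞ M]

theorem isInvertible_modelDeriv_chartAt_symm {x : M} {z : E} (hz : z ∈ (chartAt E x).target) :
    (modelDeriv (chartAt E x).symm z : E →L[ℝ] E).IsInvertible := by
  have h := isInvertible_mfderivWithin_extChartAt_symm (I := 𝓘(ℝ, E)) (x := x) (y := z)
    (by simpa using hz)
  simp only [modelWithCornersSelf_coe, range_id, mfderivWithin_univ] at h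
  simp only [mfld_simps] at h
  exact h

theorem differentiableAt_chartField [CompleteSpace E] {x : M}
    {V : M → E}
    (hV : MDifferentiableAt 𝓘(ℝ, E) 𝓘(ℝ, E).tangent
      (fun y => (⟨y, V y⟩ : TangentBundle 𝓘(ℝ, E) M)) x) :
    DifferentiableAt ℝ (chartField E x V) (chartAt E x x) := by
  have : IsManifold 𝓘(ℝ, E) 2 M := IsManifold.of_le (n := ∞) (by norm_cast)
  have h := (hV.mdifferentiableWithinAt (s := univ)).differentiableWithinAt_mpullbackWithin_vectorField
  rw [funext (mpullbackWithin_extChartAt_symm_eq x V)] at h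
  simpa [differentiableWithinAt_univ] using h

theorem chartField_self {x : M} (V : M → E) :
    chartField E x V (chartAt E x x) = V x := by
  rw [chartField, modelDeriv_chartAt_symm_self, (chartAt E x).left_inv (mem_chart_source E x)]
  simp

/-- The bracket on the manifold is computed in the chart and carried back by its differential, which
is the identity at `x`. -/
theorem mlieBracket_eq_lieBracket_chartField (x : M) (V W : Π y : M, TangentSpace 𝓘(ℝ, E) y) :
    mlieBracket 𝓘(ℝ, E) V W x =
      lieBracket ℝ (chartField E x V) (chartField E x W) (chartAt E x x) := by
  rw [← mlieBracketWithin_univ, mlieBracketWithin_apply,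
    funext (mpullbackWithin_extChartAt_symm_eq x V), funext (mpullbackWithin_extChartAt_symm_eq x W)]
  have h : (mfderiv 𝓘(ℝ, E) 𝓘(ℝ, E) (extChartAt 𝓘(ℝ, E) x) x) =
      (modelDeriv (chartAt E x) x : E →L[ℝ] E) := by
    simp only [mfld_simps]; rfl
  rw [h, modelDeriv_chartAt_self]
  simp only [modelWithCornersSelf_coe, range_id, preimage_univ, univ_inter, lieBracketWithin_univ]
  simp only [mfld_simps]
  exact congrArg (fun A : E →L[ℝ] E => A _) ContinuousLinearMap.inverse_id

/-- By the chain rule the differential of the inverse chart cancels the inverse that defines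
`chartField`. The identity is needed on a neighbourhood because it is differentiated again. -/
theorem fderiv_chartField {p : M → F} {x : M} (hp : ContMDiffAt 𝓘(ℝ, E) 𝓘(ℝ, F) ∞ p x)
    (V : M → E) :
    (fun z => fderiv ℝ (p ∘ (chartAt E x).symm) z (chartField E x V z)) =ᶠ[𝓝 (chartAt E x x)]
      (fun y => (modelDeriv p y : E →L[ℝ] F) (V y)) ∘ (chartAt E x).symm := by
  have hp' : ∀ᶠ y in 𝓝 x, MDifferentiableAt 𝓘(ℝ, E) 𝓘(ℝ, F) p y := by
    have h1 : ContMDiffAt 𝓘(ℝ, E) 𝓘(ℝ, F) 1 p x := hp.of_le (by norm_cast)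
    have : IsManifold 𝓘(ℝ, E) 1 M := IsManifold.of_le (n := ∞) (by norm_cast)
    filter_upwards [contMDiffAt_iff_contMDiffAt_nhds (by simp) |>.1 h1] with y hy using hy.mdifferentiableAt (by simp)
  have hx := mem_chart_source E x
  have hcont : Tendsto (chartAt E x).symm (𝓝 (chartAt E x x)) (𝓝 x) := by
    have := (chartAt E x).tendsto_symm hx
    exact this
  filter_upwards [hcont.eventually hp', (chartAt E x).open_target.mem_nhds
    ((chartAt E x).map_source hx)] with z hz hzt
  have hs : MDifferentiableAt 𝓘(ℝ, E) 𝓘(ℝ, E) (chartAt E x).symm z :=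
    (contMDiffAt_symm_of_mem_maximalAtlas (n := ∞)
      (IsManifold.chart_mem_maximalAtlas x) hzt).mdifferentiableAt (by simp)
  rw [← modelDeriv_eq_fderiv, modelDeriv_comp hz hs rfl]
  simp only [ContinuousLinearMap.comp_apply, chartField, Function.comp_apply]
  congr 1
  obtain ⟨A, hA⟩ := isInvertible_modelDeriv_chartAt_symm hzt
  rw [← hA]
  simp

/-- The derivative of a vector-valued function along a vector field is differentiable, and its own
derivative is the derivative of the local representative. -/
theorem mdifferentiableAt_modelDeriv_apply [CompleteSpace E] {p : M → F} {x : M}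
    (hp : ContMDiffAt 𝓘(ℝ, E) 𝓘(ℝ, F) ∞ p x) {V : M → E}
    (hV : MDifferentiableAt 𝓘(ℝ, E) 𝓘(ℝ, E).tangent
      (fun y => (⟨y, V y⟩ : TangentBundle 𝓘(ℝ, E) M)) x) :
    MDifferentiableAt 𝓘(ℝ, E) 𝓘(ℝ, F) (fun y => (modelDeriv p y : E →L[ℝ] F) (V y)) x := by
  have hx := mem_chart_source E x
  have hp2 : ContDiffAt ℝ ∞ (p ∘ (chartAt E x).symm) (chartAt E x x) :=
    (ContMDiffAt.comp_of_eq hp (contMDiffAt_chartAt_symm_self x)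
      ((chartAt E x).left_inv hx)).contDiffAt
  have hd : DifferentiableAt ℝ (fun z => fderiv ℝ (p ∘ (chartAt E x).symm) z (chartField E x V z))
      (chartAt E x x) :=
    ((hp2.fderiv_right (m := 1) (by norm_cast)).differentiableAt (by simp)).clm_apply
      (differentiableAt_chartField hV)
  have hd' := hd.congr_of_eventuallyEq (fderiv_chartField hp V).symm
  have h1 := hd'.mdifferentiableAt.comp x
    ((contMDiffAt_chartAt_self (E := E) x).mdifferentiableAt (by simp))
  refine h1.congr_of_eventuallyEq ?_
  filter_upwards [(chartAt E x).open_source.mem_nhds hx] with y hy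
  simp only [Function.comp_apply, (chartAt E x).left_inv hy]

/-- This is `[V, W] p = V (W p) - W (V p)` for a vector-valued `p`. In the chart it amounts to the
symmetry of the second derivative of `p`. -/
theorem modelDeriv_mlieBracket [CompleteSpace E] {p : M → F} {x : M}
    (hp : ContMDiffAt 𝓘(ℝ, E) 𝓘(ℝ, F) ∞ p x) {V W : Π y : M, TangentSpace 𝓘(ℝ, E) y}
    (hV : MDifferentiableAt 𝓘(ℝ, E) 𝓘(ℝ, E).tangent
      (fun y => (⟨y, V y⟩ : TangentBundle 𝓘(ℝ, E) M)) x)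
    (hW : MDifferentiableAt 𝓘(ℝ, E) 𝓘(ℝ, E).tangent
      (fun y => (⟨y, W y⟩ : TangentBundle 𝓘(ℝ, E) M)) x) :
    (modelDeriv p x : E →L[ℝ] F) (mlieBracket 𝓘(ℝ, E) V W x) =
      (modelDeriv (fun y => (modelDeriv p y : E →L[ℝ] F) (W y)) x : E →L[ℝ] F) (V x) -
        (modelDeriv (fun y => (modelDeriv p y : E →L[ℝ] F) (V y)) x : E →L[ℝ] F) (W x) := by
  have hx := mem_chart_source E x
  have hp2 : ContDiffAt ℝ ∞ (p ∘ (chartAt E x).symm) (chartAt E x x) :=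
    (ContMDiffAt.comp_of_eq hp (contMDiffAt_chartAt_symm_self x)
      ((chartAt E x).left_inv hx)).contDiffAt
  have key : ∀ {U : M → E},
      MDifferentiableAt 𝓘(ℝ, E) 𝓘(ℝ, E).tangent (fun y => (⟨y, U y⟩ : TangentBundle 𝓘(ℝ, E) M)) x →
      modelDeriv (fun y => (modelDeriv p y : E →L[ℝ] F) (U y)) x =
        fderiv ℝ (fun z => fderiv ℝ (p ∘ (chartAt E x).symm) z (chartField E x U z))
          (chartAt E x x) := fun hU => by
    rw [(fderiv_chartField hp _).fderiv_eq]
    exact (hasFDerivAt_comp_chartAt_symm (mdifferentiableAt_modelDeriv_apply hp hU)).fderiv.symm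
  have h0 : (modelDeriv p x : E →L[ℝ] F) = fderiv ℝ (p ∘ (chartAt E x).symm) (chartAt E x x) :=
    (hasFDerivAt_comp_chartAt_symm (hp.mdifferentiableAt (by simp))).fderiv.symm
  have hsymm := hp2.isSymmSndFDerivAt (by simp; norm_cast)
  rw [mlieBracket_eq_lieBracket_chartField, key hV, key hW, h0,
    fderiv_apply_lieBracket_of_isSymmSndFDerivAt (hp2.of_le (by norm_cast)) hsymm
      (differentiableAt_chartField hW) (differentiableAt_chartField hV)]
  exact congrArg₂ (· - ·) (congrArg _ (chartField_self V)) (congrArg _ (chartField_self W))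

end LieBracket

/-! ### Fields with constant coordinates near the base point. -/

section CoordinateField

variable {F : Type*} [NormedAddCommGroup F] [NormedSpace ℝ F]
  {M : Type*} [TopologicalSpace M] [ChartedSpace F M]

variable (F) in
/-- The vector field with constant coordinates `u` in the chart at `o`. -/
noncomputable def coordinateField (o : M) (u : F) : Π y : M, TangentSpace 𝓘(ℝ, F) y :=
  mpullback 𝓘(ℝ, F) 𝓘(ℝ, F) (chartAt F o) (fun _ => (u : F))

theorem mdifferentiableAt_const_field (u z : F) :
    MDifferentiableAt 𝓘(ℝ, F) 𝓘(ℝ, F).tangent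
      (fun y : F => (⟨y, u⟩ : TangentBundle 𝓘(ℝ, F) F)) z :=
  (contMDiffAt_vectorSpace_iff_contDiffAt (n := 1) (V := fun _ => (u : F))).2
    contDiffAt_const |>.mdifferentiableAt (by simp)

variable [IsManifold 𝓘(ℝ, F) ∞ M]

theorem modelDeriv_chartAt_symm_comp {o y : M} (hy : y ∈ (chartAt F o).source) :
    (modelDeriv (chartAt F o).symm (chartAt F o y) : F →L[ℝ] F).comp (modelDeriv (chartAt F o) y) =
      .id ℝ F := by
  rw [← modelDeriv_comp _ _ rfl, modelDeriv_congr (f := (chartAt F o).symm ∘ chartAt F o)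
    (g := id) ((chartAt F o).eventually_left_inverse hy), modelDeriv_id]
  · exact (contMDiffAt_symm_of_mem_maximalAtlas (n := ∞) (IsManifold.chart_mem_maximalAtlas o)
      ((chartAt F o).map_source hy)).mdifferentiableAt (by simp)
  · exact (contMDiffAt_of_mem_maximalAtlas (n := ∞) (IsManifold.chart_mem_maximalAtlas o)
      hy).mdifferentiableAt (by simp)

theorem modelDeriv_chartAt_comp {o y : M} (hy : y ∈ (chartAt F o).source) :
    (modelDeriv (chartAt F o) y : F →L[ℝ] F).comp
      (modelDeriv (chartAt F o).symm (chartAt F o y)) = .id ℝ F := by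
  rw [← modelDeriv_comp _ _ ((chartAt F o).left_inv hy), modelDeriv_congr
    (f := chartAt F o ∘ (chartAt F o).symm) (g := id)
    ((chartAt F o).eventually_right_inverse ((chartAt F o).map_source hy)), modelDeriv_id]
  · exact (contMDiffAt_of_mem_maximalAtlas (n := ∞) (IsManifold.chart_mem_maximalAtlas o)
      hy).mdifferentiableAt (by simp)
  · exact (contMDiffAt_symm_of_mem_maximalAtlas (n := ∞) (IsManifold.chart_mem_maximalAtlas o)
      ((chartAt F o).map_source hy)).mdifferentiableAt (by simp)

theorem coordinateField_apply {o y : M} (hy : y ∈ (chartAt F o).source) (u : F) :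
    coordinateField F o u y = (modelDeriv (chartAt F o).symm (chartAt F o y) : F →L[ℝ] F) u :=
  congrArg (fun A : F →L[ℝ] F => A u) (ContinuousLinearMap.inverse_eq (M := F) (M₂ := F)
    (modelDeriv_chartAt_comp hy) (modelDeriv_chartAt_symm_comp hy))

theorem coordinateField_self (o : M) (u : F) : coordinateField F o u o = u := by
  rw [coordinateField_apply (mem_chart_source F o), modelDeriv_chartAt_symm_self]
  rfl

theorem isInvertible_mfderiv_chartAt_self (o : M) :
    (mfderiv 𝓘(ℝ, F) 𝓘(ℝ, F) (chartAt F o) o).IsInvertible := by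
  have h := isInvertible_mfderiv_extChartAt (I := 𝓘(ℝ, F)) (mem_extChartAt_source o)
  simp only [mfld_simps] at h
  exact h

theorem mdifferentiableAt_coordinateField [CompleteSpace F] (o : M) (u : F) :
    MDifferentiableAt 𝓘(ℝ, F) 𝓘(ℝ, F).tangent
      (fun y : M => (⟨y, coordinateField F o u y⟩ : TangentBundle 𝓘(ℝ, F) M)) o := 
  have : IsManifold 𝓘(ℝ, F) 2 M := IsManifold.of_le (n := ∞) (by norm_cast)
  have : IsManifold 𝓘(ℝ, F) 1 M := IsManifold.of_le (n := ∞) (by norm_cast)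
  MDifferentiableAt.mpullback_vectorField (n := 2) (V := fun _ => (u : F))
    (mdifferentiableAt_const_field u _) ((contMDiffAt_chartAt_self o).of_le (by norm_cast))
    (isInvertible_mfderiv_chartAt_self o) le_rfl

theorem chartField_coordinateField (o : M) (u : F) :
    chartField F o (coordinateField F o u) =ᶠ[𝓝 (chartAt F o o)] fun _ => u := by
  filter_upwards [(chartAt F o).open_target.mem_nhds
    ((chartAt F o).map_source (mem_chart_source F o))] with z hz
  have h := coordinateField_apply ((chartAt F o).map_target hz) u
  rw [(chartAt F o).right_inv hz] at h
  obtain ⟨A, hA⟩ := isInvertible_modelDeriv_chartAt_symm hz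
  rw [← hA] at h
  change (modelDeriv (chartAt F o).symm z : F →L[ℝ] F).inverse _ = u
  rw [← hA, ContinuousLinearMap.inverse_equiv]
  exact (congrArg A.symm h).trans (A.symm_apply_apply u)

/-- In the chart both fields are constant near the point. This removes the bracket term from the
torsion. -/
theorem mlieBracket_coordinateField (o : M) (u v : F) :
    mlieBracket 𝓘(ℝ, F) (coordinateField F o u) (coordinateField F o v) o = 0 := by
  have h : lieBracket ℝ (chartField F o (coordinateField F o u))
      (chartField F o (coordinateField F o v)) (chartAt F o o) = 0 := by
    rw [((chartField_coordinateField o u).lieBracket_vectorField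
      (chartField_coordinateField o v)).eq_of_nhds]
    simp [lieBracket]
  exact (mlieBracket_eq_lieBracket_chartField o _ _).trans h

end CoordinateField

/-! ### Translation back to the base point, in coordinates. -/

section Frame

theorem inv_smul_mk {G : Type*} [Group G] {H : Subgroup G} (b : G) : b⁻¹ • (b : G ⧸ H) = (QuotientGroup.mk 1 : G ⧸ H) := by
  change ((b⁻¹ * b : G) : G ⧸ H) = _
  rw [inv_mul_cancel]

variable {E : Type*} [NormedAddCommGroup E] [NormedSpace ℝ E]
  {F : Type*} [NormedAddCommGroup F] [NormedSpace ℝ F]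
  {G : Type*} [TopologicalSpace G] [Group G] [ChartedSpace E G]
  {H : Subgroup G} [ChartedSpace F (G ⧸ H)]

variable (F H) in
/-- The translation by `b⁻¹` from the tangent space at `bH` to the one at the base point, read in
the chart at the base point. -/
noncomputable def frameMap (b : G) : F →L[ℝ] F :=
  modelDeriv (fun z : F => chartAt F (QuotientGroup.mk 1 : G ⧸ H)
    (b⁻¹ • (chartAt F (QuotientGroup.mk 1 : G ⧸ H)).symm z))
    (chartAt F (QuotientGroup.mk 1 : G ⧸ H) (b : G ⧸ H))

theorem eventually_mem_chart_source
    (hπ : Manifold.IsSubmersion 𝓘(ℝ, E) 𝓘(ℝ, F) ∞ (QuotientGroup.mk : G → G ⧸ H)) :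
    ∀ᶠ b : G in 𝓝 1, (b : G ⧸ H) ∈ (chartAt F (QuotientGroup.mk 1 : G ⧸ H)).source :=
  hπ.contMDiff.continuous.continuousAt.eventually_mem
    ((chartAt F (QuotientGroup.mk 1 : G ⧸ H)).open_source.mem_nhds (mem_chart_source F _))

variable [LieGroup 𝓘(ℝ, E) ∞ G] [IsManifold 𝓘(ℝ, F) ∞ (G ⧸ H)]

theorem mdifferentiableAt_smul
    (hπ : Manifold.IsSubmersion 𝓘(ℝ, E) 𝓘(ℝ, F) ∞ (QuotientGroup.mk : G → G ⧸ H))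
    (a : G) (y : G ⧸ H) : MDifferentiableAt 𝓘(ℝ, F) 𝓘(ℝ, F) (fun y : G ⧸ H => a • y) y :=
  (((contMDiff_quotient_smul hπ).comp (contMDiff_const.prodMk contMDiff_id)).contMDiffAt
    (x := y)).mdifferentiableAt (by simp)

/-- The chart on the target side is differentiated at its centre `o = b⁻¹ • bH`, where its
differential is the identity, so only the inverse chart at `bH` remains. -/
theorem frameMap_eq
    (hπ : Manifold.IsSubmersion 𝓘(ℝ, E) 𝓘(ℝ, F) ∞ (QuotientGroup.mk : G → G ⧸ H)) {b : G}
    (hb : (b : G ⧸ H) ∈ (chartAt F (QuotientGroup.mk 1 : G ⧸ H)).source) :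
    frameMap F H b = (modelDeriv (fun y : G ⧸ H => b⁻¹ • y) (b : G ⧸ H)).comp
      (modelDeriv (chartAt F (QuotientGroup.mk 1 : G ⧸ H)).symm
        (chartAt F (QuotientGroup.mk 1 : G ⧸ H) (b : G ⧸ H)) : F →L[ℝ] F) := by
  set φ := chartAt F (QuotientGroup.mk 1 : G ⧸ H)
  have hs : MDifferentiableAt 𝓘(ℝ, F) 𝓘(ℝ, F) φ.symm (φ (b : G ⧸ H)) :=
    (contMDiffAt_symm_of_mem_maximalAtlas (n := ∞) (IsManifold.chart_mem_maximalAtlas _)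
      (φ.map_source hb)).mdifferentiableAt (by simp)
  have ha := mdifferentiableAt_smul hπ b⁻¹ (b : G ⧸ H)
  have hbs : MDifferentiableAt 𝓘(ℝ, F) 𝓘(ℝ, F) ((fun y : G ⧸ H => b⁻¹ • y) ∘ φ.symm)
      (φ (b : G ⧸ H)) := MDifferentiableAt.comp_of_eq _ ha hs (φ.left_inv hb)
  have h1 := modelDeriv_comp (y := (QuotientGroup.mk 1 : G ⧸ H))
    ((contMDiffAt_chartAt_self (QuotientGroup.mk 1 : G ⧸ H)).mdifferentiableAt (by simp)) hbs
    (by rw [Function.comp_apply, φ.left_inv hb]; exact inv_smul_mk b)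
  rw [modelDeriv_chartAt_self, modelDeriv_comp ha hs (φ.left_inv hb)] at h1
  exact h1

theorem frameRep_coordinateField
    (hπ : Manifold.IsSubmersion 𝓘(ℝ, E) 𝓘(ℝ, F) ∞ (QuotientGroup.mk : G → G ⧸ H)) {b : G}
    (hb : (b : G ⧸ H) ∈ (chartAt F (QuotientGroup.mk 1 : G ⧸ H)).source) (u : F) :
    frameRep (coordinateField F (QuotientGroup.mk 1 : G ⧸ H) u) b = frameMap F H b u := by
  rw [frameMap_eq hπ hb]
  exact congrArg (modelDeriv (fun y : G ⧸ H => b⁻¹ • y) (b : G ⧸ H) : F →L[ℝ] F)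
    (coordinateField_apply hb u)

theorem frameMap_one
    (hπ : Manifold.IsSubmersion 𝓘(ℝ, E) 𝓘(ℝ, F) ∞ (QuotientGroup.mk : G → G ⧸ H)) :
    frameMap F H 1 = .id ℝ F := by
  have h : (fun y : G ⧸ H => (1 : G)⁻¹ • y) = id := by ext y; simp
  rw [frameMap_eq hπ (mem_chart_source F _), h, modelDeriv_id, modelDeriv_chartAt_symm_self]
  rfl

/-- `frameMap` is a partial differential of the smooth map `(b, z) ↦ φ (b⁻¹ • φ.symm z)` along the
smooth curve of points `φ (bH)`; both sides being vector spaces, the tangent coordinates are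
trivial. -/
theorem mdifferentiableAt_frameMap
    (hπ : Manifold.IsSubmersion 𝓘(ℝ, E) 𝓘(ℝ, F) ∞ (QuotientGroup.mk : G → G ⧸ H)) :
    MDifferentiableAt 𝓘(ℝ, E) 𝓘(ℝ, F →L[ℝ] F) (frameMap F H) (1 : G) := by
  set o : G ⧸ H := QuotientGroup.mk 1
  set φ := chartAt F o
  have h1 : ContMDiffAt (𝓘(ℝ, E).prod 𝓘(ℝ, F)) (𝓘(ℝ, E).prod 𝓘(ℝ, F)) ∞
      (fun q : G × F => (q.1⁻¹, φ.symm q.2)) ((1 : G), φ o) :=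
    contMDiffAt_fst.inv.prodMk
      (ContMDiffAt.comp_of_eq (contMDiffAt_chartAt_symm_self o) contMDiffAt_snd rfl)
  have h2 : ContMDiffAt (𝓘(ℝ, E).prod 𝓘(ℝ, F)) 𝓘(ℝ, F) ∞
      (fun q : G × F => q.1⁻¹ • φ.symm q.2) ((1 : G), φ o) :=
    (contMDiff_quotient_smul hπ).contMDiffAt.comp _ h1
  have h3 : ContMDiffAt (𝓘(ℝ, E).prod 𝓘(ℝ, F)) 𝓘(ℝ, F) ∞
      (Function.uncurry fun (b : G) (z : F) => φ (b⁻¹ • φ.symm z)) ((1 : G), φ o) := by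
    refine ContMDiffAt.comp_of_eq (contMDiffAt_chartAt_self o) h2 ?_
    rw [inv_one, one_smul, φ.left_inv (mem_chart_source F o)]
  have h4 : ContMDiffAt 𝓘(ℝ, E) 𝓘(ℝ, F) ∞ (fun b : G => φ (b : G ⧸ H)) 1 :=
    (contMDiffAt_chartAt_self o).comp (1 : G) hπ.contMDiff.contMDiffAt
  have h5 := ContMDiffAt.mfderiv (m := 1) (n := ∞) (fun (b : G) (z : F) => φ (b⁻¹ • φ.symm z))
    (fun b : G => φ (b : G ⧸ H)) h3 (h4.of_le (by norm_cast)) (by norm_cast)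
  have h6 := h5.mdifferentiableAt (by simp)
  refine h6.congr_of_eventuallyEq (Eventually.of_forall fun b => ?_)
  exact (congrFun (inTangentCoordinates_model_space (I := 𝓘(ℝ, F)) (I' := 𝓘(ℝ, F))
    (fun b : G => φ (b : G ⧸ H)) (fun b : G => φ (b⁻¹ • φ.symm (φ (b : G ⧸ H))))
    (frameMap F H) (1 : G)) b).symm

end Frame

/-! ### The torsion of the canonical connection. -/

section Torsion

theorem torsion_coordinateField {F : Type*} [NormedAddCommGroup F] [NormedSpace ℝ F]
    [FiniteDimensional ℝ F] {M : Type*} [TopologicalSpace M] [ChartedSpace F M]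
    [IsManifold 𝓘(ℝ, F) ∞ M]
    (cov : CovariantDerivative 𝓘(ℝ, F) F (fun x : M => TangentSpace 𝓘(ℝ, F) x)) (o : M) (u v : F) :
    (cov.torsion o u v : F) =
      cov (coordinateField F o v) o u - cov (coordinateField F o u) o v := by
  have h := cov.torsion_apply (mdifferentiableAt_coordinateField o u)
    (mdifferentiableAt_coordinateField o v)
  rw [mlieBracket_coordinateField, sub_zero, coordinateField_self, coordinateField_self] at h
  exact h

variable {E : Type*} [NormedAddCommGroup E] [NormedSpace ℝ E]
  {F : Type*} [NormedAddCommGroup F] [NormedSpace ℝ F]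
  {G : Type*} [TopologicalSpace G] [Group G] [ChartedSpace E G]
  {H : Subgroup G} [ChartedSpace F (G ⧸ H)] [IsManifold 𝓘(ℝ, F) ∞ (G ⧸ H)]

variable (F H) in
/-- The projection `G → G ⧸ H` read in the chart at the base point. -/
noncomputable def chartProj (b : G) : F :=
  chartAt F (QuotientGroup.mk 1 : G ⧸ H) (b : G ⧸ H)

theorem contMDiffAt_chartProj
    (hπ : Manifold.IsSubmersion 𝓘(ℝ, E) 𝓘(ℝ, F) ∞ (QuotientGroup.mk : G → G ⧸ H)) :
    ContMDiffAt 𝓘(ℝ, E) 𝓘(ℝ, F) ∞ (chartProj F H) (1 : G) :=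
  (contMDiffAt_chartAt_self _).comp (1 : G) hπ.contMDiff.contMDiffAt

theorem modelDeriv_chartProj
    (hπ : Manifold.IsSubmersion 𝓘(ℝ, E) 𝓘(ℝ, F) ∞ (QuotientGroup.mk : G → G ⧸ H)) {b : G}
    (hb : (b : G ⧸ H) ∈ (chartAt F (QuotientGroup.mk 1 : G ⧸ H)).source) :
    (modelDeriv (chartProj F H) b : E →L[ℝ] F) =
      (modelDeriv (chartAt F (QuotientGroup.mk 1 : G ⧸ H)) (b : G ⧸ H) : F →L[ℝ] F).comp
        (modelDeriv (QuotientGroup.mk : G → G ⧸ H) b) :=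
  modelDeriv_comp
    ((contMDiffAt_of_mem_maximalAtlas (n := ∞) (IsManifold.chart_mem_maximalAtlas _)
      hb).mdifferentiableAt (by simp))
    (hπ.contMDiff.contMDiffAt.mdifferentiableAt (by simp)) rfl

theorem modelDeriv_chartProj_one
    (hπ : Manifold.IsSubmersion 𝓘(ℝ, E) 𝓘(ℝ, F) ∞ (QuotientGroup.mk : G → G ⧸ H)) :
    (modelDeriv (chartProj F H) 1 : E →L[ℝ] F) = modelDeriv (QuotientGroup.mk : G → G ⧸ H) 1 := by
  rw [modelDeriv_chartProj hπ (mem_chart_source F _), modelDeriv_chartAt_self]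
  rfl

/-- The left invariant vector field with value `Y` at `1`, with values in the model space. -/
noncomputable def leftField (Y : E) (b : G) : E :=
  (modelDeriv (fun a : G => b * a) (1 : G) : E →L[ℝ] E) Y

theorem leftField_one (Y : E) : leftField Y (1 : G) = Y := by
  have h : (fun a : G => 1 * a) = id := by ext; simp
  rw [leftField, h, modelDeriv_id]
  rfl

variable [LieGroup 𝓘(ℝ, E) ∞ G]

theorem mdifferentiableAt_leftField (Y : E) :
    MDifferentiableAt 𝓘(ℝ, E) 𝓘(ℝ, E).tangent
      (fun g : G => (⟨g, leftField (E := E) Y g⟩ : TangentBundle 𝓘(ℝ, E) G)) 1 := by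
  have : LieGroup 𝓘(ℝ, E) (minSmoothness ℝ 3) G := LieGroup.of_le (n := ∞) (by simp; norm_cast)
  exact mdifferentiableAt_mulInvariantVectorField (I := 𝓘(ℝ, E)) (G := G)
    (show GroupLieAlgebra 𝓘(ℝ, E) G from Y)

/-- Translated back to the base point, the projection of a left invariant vector field is
constant. -/
theorem frameMap_modelDeriv_chartProj
    (hπ : Manifold.IsSubmersion 𝓘(ℝ, E) 𝓘(ℝ, F) ∞ (QuotientGroup.mk : G → G ⧸ H)) {b : G}
    (hb : (b : G ⧸ H) ∈ (chartAt F (QuotientGroup.mk 1 : G ⧸ H)).source) (Y : E) :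
    frameMap F H b ((modelDeriv (chartProj F H) b : E →L[ℝ] F) (leftField Y b)) =
      (modelDeriv (QuotientGroup.mk : G → G ⧸ H) 1 : E →L[ℝ] F) Y := by
  have hm := hπ.contMDiff.contMDiffAt (x := b) |>.mdifferentiableAt (by simp)
  have hl : MDifferentiableAt 𝓘(ℝ, E) 𝓘(ℝ, E) (fun a : G => b * a) 1 :=
    (contMDiff_mul_left (I := 𝓘(ℝ, E)) (n := ∞)).contMDiffAt.mdifferentiableAt (by simp)
  have h1 := modelDeriv_comp (x := (1 : G)) hm hl (mul_one b)
  have h2 := modelDeriv_comp (x := (1 : G)) (y := (b : G ⧸ H))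
    (mdifferentiableAt_smul hπ b⁻¹ (b : G ⧸ H))
    (MDifferentiableAt.comp_of_eq _ hm hl (mul_one b))
    (congrArg QuotientGroup.mk (mul_one b))
  -- The identity `b⁻¹ ∘ π ∘ L_b = π`; its differential at `1` is the claim, up to chart changes.
  have h3 : (fun y : G ⧸ H => b⁻¹ • y) ∘ (QuotientGroup.mk : G → G ⧸ H) ∘ (fun a : G => b * a) =
      QuotientGroup.mk := by
    ext a
    change ((b⁻¹ * (b * a) : G) : G ⧸ H) = _
    rw [inv_mul_cancel_left]
  rw [h3, h1] at h2
  have h4 := fun w : F => congrArg (fun A : F →L[ℝ] F => A w) (modelDeriv_chartAt_symm_comp hb)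
  simp only [ContinuousLinearMap.comp_apply, ContinuousLinearMap.id_apply] at h4
  rw [frameMap_eq hπ hb, modelDeriv_chartProj hπ hb]
  simp only [ContinuousLinearMap.comp_apply, h4]
  exact (congrArg (fun A : E →L[ℝ] F => A Y) h2).symm

/-- In the frame the field with coordinates `u` is `b ↦ frameMap F H b u`, and at `a = 1` the
translation back by `a` is the identity. -/
theorem canonical_coordinateField [FiniteDimensional ℝ F]
    (hπ : Manifold.IsSubmersion 𝓘(ℝ, E) 𝓘(ℝ, F) ∞ (QuotientGroup.mk : G → G ⧸ H))
    {m : Submodule ℝ (GroupLieAlgebra 𝓘(ℝ, E) G)}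
    {cov : CovariantDerivative 𝓘(ℝ, F) F (fun x : G ⧸ H => TangentSpace 𝓘(ℝ, F) x)}
    (hcov : IsCanonicalConnection m cov) {X : GroupLieAlgebra 𝓘(ℝ, E) G} (hX : X ∈ m) (u : F) :
    cov (coordinateField F (QuotientGroup.mk 1) u) (QuotientGroup.mk 1 : G ⧸ H) (dpi E F H X) =
      ((modelDeriv (frameMap F H) (1 : G) : E →L[ℝ] (F →L[ℝ] F)) X) u := by
  have h := hcov (coordinateField F (QuotientGroup.mk 1) u) 1
    (mdifferentiableAt_coordinateField _ u) X hX
  have hX1 : mulInvariantVectorField X (1 : G) = X := leftField_one (E := E) (G := G) X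
  rw [hX1] at h
  refine Eq.trans h ?_
  have h1 : (fun y : G ⧸ H => (1 : G) • y) = id := by ext y; simp
  have h2 : (modelDeriv (fun y : G ⧸ H => (1 : G) • y) (QuotientGroup.mk 1 : G ⧸ H) : F →L[ℝ] F) =
      .id ℝ F := by rw [h1, modelDeriv_id]
  have h3 : (frameRep (coordinateField F (QuotientGroup.mk 1 : G ⧸ H) u) : G → F) =ᶠ[𝓝 1]
      fun b => frameMap F H b u := by
    filter_upwards [eventually_mem_chart_source hπ] with b hb using frameRep_coordinateField hπ hb u
  have h4 : ∀ Z : E, (modelDeriv (frameRep (coordinateField F (QuotientGroup.mk 1 : G ⧸ H) u))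
      (1 : G) : E →L[ℝ] F) Z =
        ((modelDeriv (frameMap F H) (1 : G) : E →L[ℝ] (F →L[ℝ] F)) Z) u := fun Z => by
    rw [modelDeriv_congr h3]
    have h5 := modelDeriv_clm_apply (mdifferentiableAt_frameMap (F := F) (H := H) hπ)
      (mdifferentiableAt_const (c := u)) Z
    have h6 : (modelDeriv (fun _ : G => u) (1 : G) : E →L[ℝ] F) = 0 := mfderiv_const
    rw [h6] at h5
    simpa using h5
  exact (congrArg (fun A : F →L[ℝ] F => A _) h2).trans (h4 X)

variable [CompleteSpace E]

/-- The product rule applied to the constant function of `frameMap_modelDeriv_chartProj`, at `1`,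
where the frame is the identity. -/
theorem modelDeriv_frameMap_mk
    (hπ : Manifold.IsSubmersion 𝓘(ℝ, E) 𝓘(ℝ, F) ∞ (QuotientGroup.mk : G → G ⧸ H)) (X Y : E) :
    ((modelDeriv (frameMap F H) (1 : G) : E →L[ℝ] (F →L[ℝ] F)) X)
        ((modelDeriv (QuotientGroup.mk : G → G ⧸ H) 1 : E →L[ℝ] F) Y) =
      -(modelDeriv (fun b : G => (modelDeriv (chartProj F H) b : E →L[ℝ] F)
        (leftField Y b)) (1 : G) : E →L[ℝ] F) X := by
  have h0 := mdifferentiableAt_modelDeriv_apply (V := leftField Y)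
    (contMDiffAt_chartProj (F := F) (H := H) hπ) (mdifferentiableAt_leftField Y)
  have h := modelDeriv_clm_apply (mdifferentiableAt_frameMap hπ) h0 X
  have hc : (fun b : G => frameMap F H b ((modelDeriv (chartProj F H) b : E →L[ℝ] F)
      (leftField Y b))) =ᶠ[𝓝 1]
      fun _ => (modelDeriv (QuotientGroup.mk : G → G ⧸ H) 1 : E →L[ℝ] F) Y := by
    filter_upwards [eventually_mem_chart_source hπ] with b hb
    exact frameMap_modelDeriv_chartProj hπ hb Y
  have h1 : (modelDeriv (fun _ : G => (modelDeriv (QuotientGroup.mk : G → G ⧸ H) 1 : E →L[ℝ] F) Y)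
    (1 : G) : E →L[ℝ] F) = 0 := mfderiv_const
  rw [modelDeriv_congr hc, h1, frameMap_one hπ, modelDeriv_chartProj_one hπ, leftField_one] at h
  exact eq_neg_of_add_eq_zero_left h.symm

/-- After antisymmetrization the second derivatives of the projection along left-invariant fields
combine into their bracket. -/
theorem modelDeriv_frameMap_mk_sub
    (hπ : Manifold.IsSubmersion 𝓘(ℝ, E) 𝓘(ℝ, F) ∞ (QuotientGroup.mk : G → G ⧸ H)) (X Y : E) :
    ((modelDeriv (frameMap F H) (1 : G) : E →L[ℝ] (F →L[ℝ] F)) X)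
        ((modelDeriv (QuotientGroup.mk : G → G ⧸ H) 1 : E →L[ℝ] F) Y) -
      ((modelDeriv (frameMap F H) (1 : G) : E →L[ℝ] (F →L[ℝ] F)) Y)
        ((modelDeriv (QuotientGroup.mk : G → G ⧸ H) 1 : E →L[ℝ] F) X) =
      -(modelDeriv (QuotientGroup.mk : G → G ⧸ H) 1 : E →L[ℝ] F)
        (mlieBracket 𝓘(ℝ, E) (leftField X) (leftField Y) (1 : G)) := by
  have h := modelDeriv_mlieBracket (V := leftField X) (W := leftField Y)
    (contMDiffAt_chartProj (F := F) (H := H) hπ)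
    (mdifferentiableAt_leftField X) (mdifferentiableAt_leftField Y)
  rw [modelDeriv_chartProj_one hπ] at h
  rw [modelDeriv_frameMap_mk hπ, modelDeriv_frameMap_mk hπ, h, leftField_one, leftField_one]
  abel

/-- The classical formula `T(X, Y) = -[X, Y]_𝔪`. No projection to `𝔪` is written, as `dπ` performs
it when its kernel is the chosen complement. -/
theorem torsion_canonical [FiniteDimensional ℝ F]
    (hπ : Manifold.IsSubmersion 𝓘(ℝ, E) 𝓘(ℝ, F) ∞ (QuotientGroup.mk : G → G ⧸ H))
    {m : Submodule ℝ (GroupLieAlgebra 𝓘(ℝ, E) G)}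
    {cov : CovariantDerivative 𝓘(ℝ, F) F (fun x : G ⧸ H => TangentSpace 𝓘(ℝ, F) x)}
    (hcov : IsCanonicalConnection m cov) {X Y : GroupLieAlgebra 𝓘(ℝ, E) G}
    (hX : X ∈ m) (hY : Y ∈ m) :
    cov.torsion (QuotientGroup.mk 1 : G ⧸ H) (dpi E F H X) (dpi E F H Y) = -dpi E F H ⁅X, Y⁆ := by
  refine (torsion_coordinateField cov _ _ _).trans ?_
  refine (congrArg₂ (fun a b : F => a - b) (canonical_coordinateField hπ hcov hX _)
    (canonical_coordinateField hπ hcov hY _)).trans ?_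
  exact modelDeriv_frameMap_mk_sub hπ X Y

end Torsion

/-! ### Comparing two metric connections. -/

section Metric

variable {E : Type*} [NormedAddCommGroup E] [NormedSpace ℝ E]
  {F : Type*} [NormedAddCommGroup F] [NormedSpace ℝ F]
  {G : Type*} [TopologicalSpace G] [Group G] [ChartedSpace E G] [LieGroup 𝓘(ℝ, E) ∞ G]
  {H : Subgroup G} [ChartedSpace F (G ⧸ H)] [IsManifold 𝓘(ℝ, F) ∞ (G ⧸ H)]

section
variable {M : Type*} [TopologicalSpace M] [ChartedSpace F M]
  [RiemannianBundle (fun x : M => TangentSpace 𝓘(ℝ, F) x)]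

variable (F) in
/-- The metric at a point, as a bilinear form on the model space. -/
noncomputable def metricForm (x : M) : F →L[ℝ] F →L[ℝ] ℝ :=
  (innerSL ℝ : TangentSpace 𝓘(ℝ, F) x →L[ℝ] TangentSpace 𝓘(ℝ, F) x →L[ℝ] ℝ)

end

variable [RiemannianBundle (fun x : G ⧸ H => TangentSpace 𝓘(ℝ, F) x)]

/-- Translation by `b⁻¹` is an isometry carrying `bH` to `o`. The moving metric thus becomes a fixed
form on moving frame vectors, which can be differentiated by the product rule. -/
theorem metricForm_coordinateField
    (hπ : Manifold.IsSubmersion 𝓘(ℝ, E) 𝓘(ℝ, F) ∞ (QuotientGroup.mk : G → G ⧸ H))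
    (hinv : ∀ a : G, PreservesMetric (F := F) (fun y : G ⧸ H => a • y)) {b : G}
    (hb : (b : G ⧸ H) ∈ (chartAt F (QuotientGroup.mk 1 : G ⧸ H)).source) (u v : F) :
    metricForm F (b : G ⧸ H) (coordinateField F (QuotientGroup.mk 1 : G ⧸ H) u b)
        (coordinateField F (QuotientGroup.mk 1 : G ⧸ H) v b) =
      metricForm F (QuotientGroup.mk 1 : G ⧸ H) (frameMap F H b u) (frameMap F H b v) := by
  rw [← frameRep_coordinateField hπ hb u, ← frameRep_coordinateField hπ hb v, ← inv_smul_mk b]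
  exact (hinv b⁻¹ (b : G ⧸ H) _ _).symm

variable [FiniteDimensional ℝ F]
  [IsContMDiffRiemannianBundle 𝓘(ℝ, F) ∞ F (fun x : G ⧸ H => TangentSpace 𝓘(ℝ, F) x)]

/-- The canonical connection of an invariant metric is metric at the base point. -/
theorem modelDeriv_metricForm
    (hπ : Manifold.IsSubmersion 𝓘(ℝ, E) 𝓘(ℝ, F) ∞ (QuotientGroup.mk : G → G ⧸ H))
    (hinv : ∀ a : G, PreservesMetric (F := F) (fun y : G ⧸ H => a • y)) (X : E) (u v : F) :
    (modelDeriv (fun y : G ⧸ H => metricForm F y (coordinateField F (QuotientGroup.mk 1 : G ⧸ H) u y)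
        (coordinateField F (QuotientGroup.mk 1 : G ⧸ H) v y))
        (QuotientGroup.mk 1 : G ⧸ H) : F →L[ℝ] ℝ)
        ((modelDeriv (QuotientGroup.mk : G → G ⧸ H) 1 : E →L[ℝ] F) X) =
      metricForm F (QuotientGroup.mk 1 : G ⧸ H)
        ((modelDeriv (frameMap F H) (1 : G) : E →L[ℝ] (F →L[ℝ] F)) X u) v +
      metricForm F (QuotientGroup.mk 1 : G ⧸ H) u
        ((modelDeriv (frameMap F H) (1 : G) : E →L[ℝ] (F →L[ℝ] F)) X v) := by
  set o : G ⧸ H := QuotientGroup.mk 1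
  have hf : MDifferentiableAt 𝓘(ℝ, F) 𝓘(ℝ, ℝ) (fun y : G ⧸ H =>
      metricForm F y (coordinateField F o u y) (coordinateField F o v y)) o :=
    MDifferentiableAt.inner_bundle (F := F) (E := fun y : G ⧸ H => TangentSpace 𝓘(ℝ, F) y)
      (b := id) (v := coordinateField F o u) (w := coordinateField F o v)
      (mdifferentiableAt_coordinateField o u) (mdifferentiableAt_coordinateField o v)
  have hc := modelDeriv_comp (x := (1 : G)) hf
    (hπ.contMDiff.contMDiffAt.mdifferentiableAt (by simp)) rfl
  have hev : (fun y : G ⧸ H => metricForm F y (coordinateField F o u y) (coordinateField F o v y)) ∘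
      (QuotientGroup.mk : G → G ⧸ H) =ᶠ[𝓝 1]
      fun b => metricForm F o (frameMap F H b u) (frameMap F H b v) := by
    filter_upwards [eventually_mem_chart_source hπ] with b hb
      using metricForm_coordinateField hπ hinv hb u v
  have hD := mdifferentiableAt_frameMap (F := F) (H := H) hπ
  have hDu : ∀ w : F, MDifferentiableAt 𝓘(ℝ, E) 𝓘(ℝ, F) (fun b => frameMap F H b w) (1 : G) :=
    fun w => hD.clm_apply mdifferentiableAt_const
  have hDd : ∀ w : F, (modelDeriv (fun b => frameMap F H b w) (1 : G) : E →L[ℝ] F) X =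
      (modelDeriv (frameMap F H) (1 : G) : E →L[ℝ] (F →L[ℝ] F)) X w := fun w => by
    have h5 := modelDeriv_clm_apply hD (mdifferentiableAt_const (c := w)) X
    have h6 : (modelDeriv (fun _ : G => w) (1 : G) : E →L[ℝ] F) = 0 := mfderiv_const
    rw [h6] at h5
    simpa using h5
  have hB : MDifferentiableAt 𝓘(ℝ, E) 𝓘(ℝ, F →L[ℝ] ℝ)
      (fun b => metricForm F o (frameMap F H b u)) (1 : G) :=
    ((metricForm F o).differentiableAt.mdifferentiableAt).comp (1 : G) (hDu u)
  have hBd : (modelDeriv (fun b => metricForm F o (frameMap F H b u)) (1 : G) : E →L[ℝ] F →L[ℝ] ℝ) X =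
      metricForm F o ((modelDeriv (frameMap F H) (1 : G) : E →L[ℝ] (F →L[ℝ] F)) X u) := by
    have h7 := modelDeriv_comp (x := (1 : G)) (metricForm F o).differentiableAt.mdifferentiableAt
      (hDu u) rfl
    rw [modelDeriv_eq_fderiv, ContinuousLinearMap.fderiv] at h7
    rw [← hDd]
    exact congrArg (fun A : E →L[ℝ] F →L[ℝ] ℝ => A X) h7
  rw [modelDeriv_congr hev] at hc
  rw [← ContinuousLinearMap.comp_apply, ← hc, modelDeriv_clm_apply hB (hDu v), hBd, hDd,
    frameMap_one hπ]
  rfl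

theorem half_smul_cancel {F : Type*} [NormedAddCommGroup F] [NormedSpace ℝ F]
    (B : F →L[ℝ] F →L[ℝ] ℝ) (a b s t u v : F)
    (h : B (a + (1 / 2 : ℝ) • s) v + B u (b + (1 / 2 : ℝ) • t) = B a v + B u b) :
    B s v + B u t = 0 := by
  simp only [map_add, map_smul, add_apply, smul_apply, smul_eq_mul] at h
  linarith

/-- The Levi-Civita and canonical connections both obey the Leibniz rule for the metric at `o`, and
they differ there by `½T`; subtracting the two rules leaves only the torsion terms. -/
theorem metricForm_torsion_skew
    (hπ : Manifold.IsSubmersion 𝓘(ℝ, E) 𝓘(ℝ, F) ∞ (QuotientGroup.mk : G → G ⧸ H))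
    (hinv : ∀ a : G, PreservesMetric (F := F) (fun y : G ⧸ H => a • y))
    {m : Submodule ℝ (GroupLieAlgebra 𝓘(ℝ, E) G)}
    {cov covLC : CovariantDerivative 𝓘(ℝ, F) F (fun x : G ⧸ H => TangentSpace 𝓘(ℝ, F) x)}
    (hcov : IsCanonicalConnection m cov) (hLC : IsLeviCivita covLC)
    (heq : Coincide covLC (torsionFreePart cov)) {X : GroupLieAlgebra 𝓘(ℝ, E) G} (hX : X ∈ m)
    (u v : F) :
    metricForm F (QuotientGroup.mk 1 : G ⧸ H)
        (cov.torsion (QuotientGroup.mk 1 : G ⧸ H) u (dpi E F H X)) v +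
      metricForm F (QuotientGroup.mk 1 : G ⧸ H) u
        (cov.torsion (QuotientGroup.mk 1 : G ⧸ H) v (dpi E F H X)) = 0 := by
  set o : G ⧸ H := QuotientGroup.mk 1
  have hu : ∀ w : F, (covLC (coordinateField F o w) o (dpi E F H X) : F) =
      (modelDeriv (frameMap F H) (1 : G) : E →L[ℝ] (F →L[ℝ] F)) X w +
        ((1 / 2 : ℝ) • (show F from cov.torsion o w (dpi E F H X)) : F) := fun w => by
    rw [heq _ o (mdifferentiableAt_coordinateField o w), ← canonical_coordinateField hπ hcov hX w]
    have : torsionFreePart cov (coordinateField F o w) o =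
        cov (coordinateField F o w) o + ((1 / 2 : ℝ) • cov.torsion o) (coordinateField F o w o) :=
      rfl
    rw [this, coordinateField_self]
    rfl
  have h1 : (modelDeriv (fun y : G ⧸ H =>
      metricForm F y (coordinateField F o u y) (coordinateField F o v y)) o : F →L[ℝ] ℝ)
        (coordinateField F o (dpi E F H X : F) o) =
      metricForm F o (covLC (coordinateField F o u) o (coordinateField F o (dpi E F H X : F) o))
        (coordinateField F o v o) +
      metricForm F o (coordinateField F o u o)
        (covLC (coordinateField F o v) o (coordinateField F o (dpi E F H X : F) o)) :=
    hLC.2.mvfderiv_inner_eq (coordinateField F o (dpi E F H X : F))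
    (mdifferentiableAt_coordinateField o u) (mdifferentiableAt_coordinateField o v)
  rw [coordinateField_self o u, coordinateField_self o v,
    coordinateField_self (F := F) o (dpi E F H X)] at h1
  have h2 := modelDeriv_metricForm hπ hinv X u v
  have h3 : metricForm F o (covLC (coordinateField F o u) o (dpi E F H X)) v +
      metricForm F o u (covLC (coordinateField F o v) o (dpi E F H X)) =
      metricForm F o ((modelDeriv (frameMap F H) (1 : G) : E →L[ℝ] (F →L[ℝ] F)) X u) v +
      metricForm F o u ((modelDeriv (frameMap F H) (1 : G) : E →L[ℝ] (F →L[ℝ] F)) X v) :=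
    h1.symm.trans h2
  rw [hu, hu] at h3
  exact half_smul_cancel (metricForm F o) _ _ _ _ _ _ h3

end Metric

end GammaSymmetric

/-! ### Natural reductivity. -/

theorem mainTheorem5
    {E : Type*} [NormedAddCommGroup E] [NormedSpace ℝ E] [FiniteDimensional ℝ E]
    {F : Type*} [NormedAddCommGroup F] [NormedSpace ℝ F] [FiniteDimensional ℝ F]
    {G : Type*} [TopologicalSpace G] [T2Space G] [ConnectedSpace G] [Group G]
    [ChartedSpace E G] [LieGroup 𝓘(ℝ, E) ∞ G]
    {Γ : Type*} [CommGroup Γ] [Finite Γ]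
    (ρ : Γ →* MulAut G) (H : Subgroup G)
    (hsym : GammaSymmetric.IsGammaSymmetric E ρ H)
    -- the manifold structure of `G ⧸ H` is the one for which the projection is a submersion
    [ChartedSpace F (G ⧸ H)] [IsManifold 𝓘(ℝ, F) ∞ (G ⧸ H)]
    (hπ : Manifold.IsSubmersion 𝓘(ℝ, E) 𝓘(ℝ, F) ∞ (QuotientGroup.mk : G → G ⧸ H))
    -- the Riemannian metric of `G ⧸ H`
    [RiemannianBundle (fun x : G ⧸ H => TangentSpace 𝓘(ℝ, F) x)]
    [IsContMDiffRiemannianBundle 𝓘(ℝ, F) ∞ F (fun x : G ⧸ H => TangentSpace 𝓘(ℝ, F) x)]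
    (hriem : GammaSymmetric.IsRiemannianGammaSymmetric F ρ hsym.le_fixed)
    (hadapted : GammaSymmetric.IsAdapted F (H := H) (GammaSymmetric.mPart E ρ)) :
    GammaSymmetric.IsNaturallyReductive F H
      (GammaSymmetric.gE E ρ) (GammaSymmetric.mPart E ρ) := by
  obtain ⟨covLC, covCan, hLC, hcan, heq⟩ := hadapted
  cases nonempty_fintype Γ
  have hcomplete : CompleteSpace E := FiniteDimensional.complete ℝ E
  have hker : (GammaSymmetric.dpi E F H).ker = GammaSymmetric.gE E ρ := by
    ext X
    refine ⟨fun hX => GammaSymmetric.mem_gE.2 fun γ =>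
      GammaSymmetric.modelDeriv_eq_self_of_mk_eq_zero hπ (hsym.contMDiff γ)
        (fun a ha => hsym.le_fixed ha γ) hX, fun hX => ?_⟩
    exact GammaSymmetric.modelDeriv_mk_eq_zero_of_fixed hsym.contMDiff
      hsym.identityComponent_subset (hπ.contMDiff.contMDiffAt.mdifferentiableAt (by simp))
      (GammaSymmetric.mem_gE.1 hX)
  have hcompl := GammaSymmetric.isCompl_mPart_gE hsym.contMDiff
  -- Since `𝔤_e` is the kernel of `dπ`, passing to the `𝔪`-component of a bracket does not change
  -- its image, so the form `B` does not see the projection.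
  have hproj : ∀ W, GammaSymmetric.dpi E F H
      ((GammaSymmetric.mPart E ρ).projection (GammaSymmetric.gE E ρ) hcompl W) =
        GammaSymmetric.dpi E F H W := fun W => by
    have h : W - (GammaSymmetric.mPart E ρ).projection (GammaSymmetric.gE E ρ) hcompl W ∈
        (GammaSymmetric.dpi E F H).ker := by
      rw [hker]
      exact Submodule.sub_projection_mem hcompl W
    have h' : GammaSymmetric.dpi E F H
      (W - (GammaSymmetric.mPart E ρ).projection (GammaSymmetric.gE E ρ) hcompl W) = 0 := h
    rw [map_sub, sub_eq_zero] at h'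
    exact h'.symm
  refine ⟨hker, hcompl, fun a ha X hX =>
    GammaSymmetric.Ad_mem_mPart hsym.contMDiff (hsym.le_fixed ha) hX, fun X hX Y hY Z hZ => ?_⟩
  have h := GammaSymmetric.metricForm_torsion_skew hπ hriem.invariant hcan hLC heq hZ
    (GammaSymmetric.dpi E F H X) (GammaSymmetric.dpi E F H Y)
  rw [GammaSymmetric.torsion_canonical hπ hcan hX hZ,
    GammaSymmetric.torsion_canonical hπ hcan hY hZ] at h
  -- The sign of the torsion formula is absorbed by swapping the bracket: `-[X, Z] = [Z, X]`.
  have hs : ∀ W W' : GroupLieAlgebra 𝓘(ℝ, E) G, -GammaSymmetric.dpi E F H ⁅W, W'⁆ =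
      GammaSymmetric.dpi E F H ⁅W', W⁆ := fun W W' => by
    rw [← map_neg, GroupLieAlgebra.bracket_def, GroupLieAlgebra.bracket_def,
      VectorField.mlieBracket_swap_apply, neg_neg]
  rw [hs, hs, add_comm] at h
  simp only [GammaSymmetric.formB, hproj]
  exact h
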